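/- Let $(\Omega,\mathcal F,\mathbb P_0)$ be a probability space and $X\in L^1(\mathbb P_0)$ real-valued. Let $\Phi_0$ be the set of convex functions $\phi:\mathbb R\to[0,\infty]$ with $\phi(1)=0$ whose effective domain $\{\phi<\infty\}$ is contained in $[0,\infty)$ and contains a neighbourhood of $1$. For $\phi\in\Phi_0$ put $I_\phi(\mathbb Q,\mathbb P)=\int\phi\left(\frac{d\mathbb Q}{d\mathbb P}\right)d\mathbb P$ if $\mathbb Q\ll\mathbb P$ and $I_\phi(\mathbb Q,\mathbb P)=+\infty$ otherwise. Let $\phi^*(s)=\sup_{t\in\mathbb R}\{st-\phi(t)\}$ be the convex conjugate, with $\phi^*(+\infty)=+\infty$, and set $0\,\phi^*(s/0)=0$ if $s\le 0$ and $0\,\phi^*(s/0)=+\infty$ if $s>0$. Let $\phi_1,\phi_2,\phi_3\in\Phi_0$ be lower semicontinuous and let $r>0$. Define the globalized robust OCE risk measure $$\rho^g_{\mathrm{oce},\mathbb P_0}(X)=\sup_{\mathbb P:\,I_{\phi_3}(\mathbb P,\mathbb P_0)\le r}\ \sup_{\mathbb Q\ll\mathbb P}\ \sup_{\bar{\mathbb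 Q}\ll\mathbb Q}\ \mathbb E_{\bar{\mathbb Q}}[-X]-I_{\phi_1}(\bar{\mathbb Q},\mathbb Q)-I_{\phi_2}(\mathbb Q,\mathbb P),$$ where $\mathbb P,\mathbb Q,\bar{\mathbb Q}$ range over probability measures on $(\Omega,\mathcal F)$, all expectations are taken in $[-\infty,\infty]$, and triples for which the objective is of the form $\infty-\infty$ do not count. Then, as an identity in $(-\infty,\infty]$, $$\rho^g_{\mathrm{oce},\mathbb P_0}(X)=\inf_{\lambda\ge 0,\ \theta_1,\theta_2,\theta_3\in\mathbb R}\ -\theta_1-\theta_2-\theta_3+\lambda r+\mathbb E_{\mathbb P_0}\left[\lambda\,\phi_3^*\left(\frac{\phi_2^*\left(\phi_1^*(\theta_3-X)+\theta_2\right)+\theta_1}{\lambda}\right)\right].$$ -/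

import Mathlib

open MeasureTheory Set
open scoped NNReal ENNReal Topology

noncomputable section

namespace GlobalizedOCE

/-- The class of divergence functions: convex functions on the real line with values in `[0, ∞]`,
normalized by `φ 1 = 0`, with effective domain contained in `[0, ∞)` and containing a
neighbourhood of `1`. -/
structure IsDivergenceFunction (φ : ℝ → ℝ≥0∞) : Prop where
  convex : ∀ x y a b : ℝ, 0 ≤ a → 0 ≤ b → a + b = 1 →
    φ (a * x + b * y) ≤ ENNReal.ofReal a * φ x + ENNReal.ofReal b * φ y
  map_one : φ 1 = 0
  dom_subset : {t : ℝ | φ t < ∞} ⊆ Ici 0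
  dom_mem_nhds : {t : ℝ | φ t < ∞} ∈ 𝓝 (1 : ℝ)

/-- The convex conjugate `φ* s = sup_t (s t - φ t)`. The argument may be infinite, because
conjugates are composed below: for a divergence function, the formula gives `φ* (+∞) = +∞`. -/
def conj (φ : ℝ → ℝ≥0∞) (s : EReal) : EReal :=
  ⨆ t : ℝ, (s * (t : EReal) - (φ t : EReal))

/-- `lam φ*(s / lam)` for `lam ≥ 0`, with the convention that `0 φ*(s / 0)` is `0` if `s ≤ 0` and
`+∞` if `s > 0`. -/
def perspConj (φ : ℝ → ℝ≥0∞) (lam : ℝ≥0) (s : EReal) : EReal :=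
  if lam = 0 then (if s ≤ 0 then 0 else ⊤)
  else ((lam : ℝ) : EReal) * conj φ (s / ((lam : ℝ) : EReal))

variable {Ω : Type*} [MeasurableSpace Ω]

open Classical in
/-- The `φ`-divergence `I_φ(Q, P)`: the integral of `φ (dQ/dP)` against `P` if `Q ≪ P`, and `+∞`
otherwise. -/
def divergence (φ : ℝ → ℝ≥0∞) (Q P : Measure Ω) : ℝ≥0∞ :=
  if Q ≪ P then ∫⁻ ω, φ (Q.rnDeriv P ω).toReal ∂P else ∞

/-- The expectation of an extended-real random variable, as the integral of the positive part minus
that of the negative part. If both are infinite the value is `⊥` (Mathlib's `⊤ - ⊤ = ⊥`). -/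
def expectation (P : Measure Ω) (Y : Ω → EReal) : EReal :=
  ((∫⁻ ω, (Y ω).toENNReal ∂P : ℝ≥0∞) : EReal) - ((∫⁻ ω, (-Y ω).toENNReal ∂P : ℝ≥0∞) : EReal)

/-- The globalized robust OCE risk measure: the supremum of
`E_{Q'}[-X] - I_{φ₁}(Q', Q) - I_{φ₂}(Q, P)` over probability measures `P`, `Q`, `Q'` with
`I_{φ₃}(P, P₀) ≤ r`, `Q ≪ P` and `Q' ≪ Q`. An indeterminate `∞ - ∞` in the objective evaluates to
`⊥` in `EReal` and so does not contribute to the supremum. -/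
def globalizedOCE (φ₁ φ₂ φ₃ : ℝ → ℝ≥0∞) (r : ℝ) (P₀ : Measure Ω) (X : Ω → ℝ) : EReal :=
  ⨆ (P : Measure Ω) (_ : IsProbabilityMeasure P) (_ : divergence φ₃ P P₀ ≤ ENNReal.ofReal r),
  ⨆ (Q : Measure Ω) (_ : IsProbabilityMeasure Q) (_ : Q ≪ P),
  ⨆ (Q' : Measure Ω) (_ : IsProbabilityMeasure Q') (_ : Q' ≪ Q),
    expectation Q' (fun ω => ((-X ω : ℝ) : EReal))
      - (divergence φ₁ Q' Q : EReal) - (divergence φ₂ Q P : EReal)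

/-- The dual integrand `γ*(x, θ₁, θ₂, θ₃, lam) = lam φ₃*((φ₂*(φ₁*(θ₃ - x) + θ₂) + θ₁) / lam)`. -/
def gammaStar (φ₁ φ₂ φ₃ : ℝ → ℝ≥0∞) (x θ₁ θ₂ θ₃ : ℝ) (lam : ℝ≥0) : EReal :=
  perspConj φ₃ lam (conj φ₂ (conj φ₁ ((θ₃ - x : ℝ) : EReal) + (θ₂ : EReal)) + (θ₁ : EReal))

end GlobalizedOCE

end

/-!
The identity is Lagrangian duality for a concave maximization with four scalar constraints. Write
`u`, `v`, `w` for the densities of `P`, `Q`, `Q'` with respect to `P₀`. The objective becomes the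
integral of the gain `-w x - v φ₁(w/v) - u φ₂(v/u)`, which is jointly concave because perspectives
of convex functions are convex; the constraints are `E u = E v = E w = 1` and `E φ₃(u) ≤ r`.
Pricing them at `θ₁`, `θ₂`, `θ₃`, `lam` gives the pointwise Lagrangian, whose supremum over
`u, v, w` is the composed conjugate `gammaStar` when `lam > 0`.

Weak duality (`objective_le_dual`) integrates the Fenchel inequality `le_gammaStar`. It also covers
`lam = 0`, where the convention for `0 φ₃*(s / 0)` only makes the integrand larger than the true
supremum of the Lagrangian.

For strong duality (`dual_le_globalizedOCE`) it is enough to use positive bounded densities with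
bounded divergence integrands (`IsBoundedDensity`), for which every integral is finite. Constant
densities near `1` provide a Slater condition (`eventually_mem_valueHypograph`), so a separating
hyperplane of the convex set `valueHypograph` yields multipliers (`exists_supergradient`). Raising
`lam` by a small amount costs little and makes it positive. The supremum and the integral are then
interchanged (`expectation_gammaStar_le`): `gammaStar` is the supremum of the Lagrangian over
countably many rational triples (`exists_rat_lt_lagrangian`), the maximum over finitely many of them
is attained by bounded densities obtained by pasting, and monotone convergence concludes.
-/

namespace GlobalizedOCE

/-! ### Lagrange multipliers -/

/-- A Lagrange multiplier theorem: the hypograph-like convex set `A` has a supporting affine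
function at `x₀`, because the Slater condition `hm` makes its interior nonempty and forbids a
vertical separating hyperplane. -/
theorem exists_supergradient {E : Type*} [NormedAddCommGroup E] [NormedSpace ℝ E]
    {A : Set (E × ℝ)} (hA : Convex ℝ A)
    (hdown : ∀ x y y', (x, y) ∈ A → y' ≤ y → (x, y') ∈ A) {x₀ : E} {m L : ℝ}
    (hm : ∀ᶠ x in 𝓝 x₀, (x, m) ∈ A) (hL : ∀ y, (x₀, y) ∈ A → y ≤ L) :
    ∃ l : E →L[ℝ] ℝ, ∀ p ∈ A, p.2 ≤ L + l (p.1 - x₀) := by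
  have hint : (x₀, m - 1) ∈ interior A := by
    rw [mem_interior_iff_mem_nhds, nhds_prod_eq]
    filter_upwards [hm.prod_mk (Iio_mem_nhds (sub_one_lt m))] with p hp
    exact hdown _ _ _ hp.1 (le_of_lt hp.2)
  have hnot : (x₀, L) ∉ interior A := by
    intro h
    rw [mem_interior_iff_mem_nhds] at h
    have hc : Filter.Tendsto (fun y : ℝ => (x₀, y)) (𝓝 L) (𝓝 (x₀, L)) :=
      (Continuous.prodMk_right x₀).tendsto L
    obtain ⟨y, hy, hLy⟩ := ((hc.eventually h).filter_mono nhdsWithin_le_nhds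
      |>.and (self_mem_nhdsWithin (s := Ioi L))).exists
    exact absurd (hL y hy) (not_le.2 hLy)
  obtain ⟨F, hF⟩ := geometric_hahn_banach_open_point hA.interior isOpen_interior hnot
  have hcl : ∀ a ∈ A, F a ≤ F (x₀, L) := by
    have hsub : closure (interior A) ⊆ {a | F a ≤ F (x₀, L)} :=
      closure_minimal (fun a ha => (hF a ha).le)
        (isClosed_le F.continuous continuous_const)
    rw [hA.closure_interior_eq_closure_of_nonempty_interior ⟨_, hint⟩] at hsub
    exact fun a ha => hsub (subset_closure ha)
  have hdec : ∀ x y, F (x, y) = F (x, 0) + F (0, 1) * y := by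
    intro x y
    have : ((x, y) : E × ℝ) = (x, 0) + y • (0, 1) := by simp
    rw [this, map_add, map_smul, smul_eq_mul, mul_comm]
  have hmL : m ≤ L := hL m hm.self_of_nhds
  have hpos : 0 < F (0, 1) := by
    have := hF _ hint
    rw [hdec x₀ (m - 1), hdec x₀ L] at this
    nlinarith
  refine ⟨-(F (0, 1))⁻¹ • F.comp (ContinuousLinearMap.inl ℝ E ℝ), fun p hp => ?_⟩
  have h := hcl p hp
  rw [← Prod.mk.eta (p := p), hdec p.1 p.2, hdec x₀ L] at h
  have hsub : F (p.1 - x₀, 0) = F (p.1, 0) - F (x₀, 0) := by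
    rw [← map_sub]; simp
  simp only [smul_apply, ContinuousLinearMap.comp_apply,
    ContinuousLinearMap.inl_apply, smul_eq_mul, hsub]
  refine le_of_mul_le_mul_left ?_ hpos
  rw [mul_add, ← mul_assoc, mul_neg, mul_inv_cancel₀ hpos.ne']
  linarith

/-! ### Divergence functions and their conjugates -/

namespace IsDivergenceFunction

variable {φ : ℝ → ℝ≥0∞}

theorem nonneg_of_ne_top (h : IsDivergenceFunction φ) {t : ℝ} (ht : φ t ≠ ∞) : 0 ≤ t :=
  h.dom_subset (lt_top_iff_ne_top.2 ht)

/-- Convexity on the segment from `1` to `t`, where `φ 1 = 0`. -/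
theorem map_segment_one_le (h : IsDivergenceFunction φ) (t : ℝ) {a : ℝ} (ha : 0 ≤ a)
    (ha1 : a ≤ 1) : φ (1 + a * (t - 1)) ≤ ENNReal.ofReal a * φ t := by
  have := h.convex t 1 a (1 - a) ha (by linarith) (by ring)
  rw [h.map_one, mul_zero, add_zero] at this
  convert this using 2
  ring

theorem tendsto_one (h : IsDivergenceFunction φ) : Filter.Tendsto φ (𝓝 1) (𝓝 0) := by
  obtain ⟨e, he, hball⟩ := Metric.mem_nhds_iff.1 h.dom_mem_nhds
  have hd : ∀ s : ℝ, |s| = 1 → φ (1 + s * (e / 2)) ≠ ∞ := by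
    intro s hs
    refine (hball (?_ : 1 + s * (e / 2) ∈ Metric.ball (1 : ℝ) e)).ne
    rw [Metric.mem_ball, Real.dist_eq, add_sub_cancel_left, abs_mul, hs, abs_of_pos (by linarith)]
    linarith
  set C := max (φ (1 + 1 * (e / 2))) (φ (1 + (-1) * (e / 2))) with hC
  have hCtop : C ≠ ∞ := by
    rcases max_choice (φ (1 + 1 * (e / 2))) (φ (1 + (-1) * (e / 2))) with h' | h' <;>
      rw [hC, h']
    · exact hd 1 (by simp)
    · exact hd (-1) (by simp)
  have hlim : Filter.Tendsto (fun t : ℝ => ENNReal.ofReal (|t - 1| / (e / 2)) * C) (𝓝 1) (𝓝 0) := by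
    have : Filter.Tendsto (fun t : ℝ => ENNReal.ofReal (|t - 1| / (e / 2))) (𝓝 1) (𝓝 0) := by
      have hc : Continuous (fun t : ℝ => ENNReal.ofReal (|t - 1| / (e / 2))) :=
        ENNReal.continuous_ofReal.comp (by fun_prop)
      simpa using hc.tendsto 1
    simpa using ENNReal.Tendsto.mul_const this (Or.inr hCtop)
  refine tendsto_of_tendsto_of_tendsto_of_le_of_le' tendsto_const_nhds hlim
    (Filter.Eventually.of_forall fun _ => zero_le) ?_
  filter_upwards [Metric.ball_mem_nhds (1 : ℝ) (half_pos he)] with t ht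
  rw [Metric.mem_ball, Real.dist_eq] at ht
  have he2 : 0 < e / 2 := half_pos he
  have ha1 : |t - 1| / (e / 2) ≤ 1 := (div_le_one he2).2 ht.le
  rcases le_total 1 t with h1 | h1
  · have := h.map_segment_one_le (1 + 1 * (e / 2)) (by positivity) ha1
    rw [abs_of_nonneg (by linarith)] at this ⊢
    rw [show 1 + (t - 1) / (e / 2) * (1 + 1 * (e / 2) - 1) = t by field_simp; ring] at this
    exact this.trans (by gcongr; exact le_max_left _ _)
  · have := h.map_segment_one_le (1 + (-1) * (e / 2)) (by positivity) ha1
    rw [abs_of_nonpos (by linarith)] at this ⊢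
    rw [show 1 + -(t - 1) / (e / 2) * (1 + (-1) * (e / 2) - 1) = t by field_simp; ring] at this
    exact this.trans (by gcongr; exact le_max_right _ _)

theorem toReal_convex (h : IsDivergenceFunction φ) {x y a b : ℝ} (hx : φ x ≠ ∞) (hy : φ y ≠ ∞)
    (ha : 0 ≤ a) (hb : 0 ≤ b) (hab : a + b = 1) :
    (φ (a * x + b * y)).toReal ≤ a * (φ x).toReal + b * (φ y).toReal := by
  have := ENNReal.toReal_mono (by finiteness) (h.convex x y a b ha hb hab)
  rwa [ENNReal.toReal_add (by finiteness) (by finiteness), ENNReal.toReal_mul, ENNReal.toReal_mul,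
    ENNReal.toReal_ofReal ha, ENNReal.toReal_ofReal hb] at this

end IsDivergenceFunction

/-- The Fenchel inequality, at real arguments. -/
theorem le_conj {φ : ℝ → ℝ≥0∞} {s : EReal} {s' t : ℝ} (hs : (s' : EReal) ≤ s) (ht : 0 ≤ t)
    (hφ : φ t ≠ ∞) : ((s' * t - (φ t).toReal : ℝ) : EReal) ≤ conj φ s := by
  refine le_trans ?_ (le_iSup (fun t : ℝ => s * (t : EReal) - (φ t : EReal)) t)
  rw [← EReal.coe_ennreal_toReal hφ, EReal.coe_sub, EReal.coe_mul]
  exact EReal.sub_le_sub (mul_le_mul_of_nonneg_right hs (by exact_mod_cast ht)) le_rfl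

theorem le_conj_self {φ : ℝ → ℝ≥0∞} (h : IsDivergenceFunction φ) {s : EReal} {s' : ℝ}
    (hs : (s' : EReal) ≤ s) : (s' : EReal) ≤ conj φ s := by
  simpa [h.map_one] using le_conj (φ := φ) hs zero_le_one (by simp [h.map_one])

/-- The supremum that defines the conjugate is approached along positive rational points of the
effective domain: a point `t` of the domain is approximated from within the segment from `1` to
`t`, on which `φ` is at most its linear interpolation. -/
theorem exists_rat_lt_of_lt_conj {φ : ℝ → ℝ≥0∞} (h : IsDivergenceFunction φ) {s : EReal}
    (hs : s ≠ ⊥) {c : ℝ} (hc : (c : EReal) < conj φ s) :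
    ∃ q : ℚ, 0 < q ∧ φ q ≠ ∞ ∧ ∃ s' : ℝ, (s' : EReal) < s ∧ c < s' * q - (φ q).toReal := by
  have hone := h.map_one
  induction s with
  | bot => exact absurd rfl hs
  | top =>
    exact ⟨1, one_pos, by simp [hone], c + 1, EReal.coe_lt_top _, by simp [hone]⟩
  | coe s =>
    suffices ∃ q : ℚ, 0 < q ∧ φ q ≠ ∞ ∧ c < s * q - (φ q).toReal by
      obtain ⟨q, hq, hφ, hcq⟩ := this
      have hlim : Filter.Tendsto (fun s' : ℝ => s' * q - (φ q).toReal) (𝓝[<] s)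
          (𝓝 (s * q - (φ q).toReal)) :=
        ((continuous_id.mul continuous_const).sub continuous_const).continuousWithinAt
      obtain ⟨s', h1, h2⟩ := ((hlim.eventually (lt_mem_nhds hcq)).and self_mem_nhdsWithin).exists
      exact ⟨q, hq, hφ, s', by exact_mod_cast h2, h1⟩
    obtain ⟨t, ht⟩ := lt_iSup_iff.1 hc
    have hφ : φ t ≠ ∞ := by
      intro h'
      rw [h', EReal.coe_ennreal_top, EReal.sub_top] at ht
      exact not_lt_bot ht
    have h0 := h.nonneg_of_ne_top hφ
    rw [← EReal.coe_ennreal_toReal hφ, ← EReal.coe_mul, ← EReal.coe_sub, EReal.coe_lt_coe_iff]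
      at ht
    rcases eq_or_ne t 1 with rfl | ht1
    · exact ⟨1, one_pos, by simp [hone], by simpa using ht⟩
    have hlim : Filter.Tendsto (fun a : ℝ => s * (1 + a * (t - 1)) - a * (φ t).toReal) (𝓝[<] 1)
        (𝓝 (s * (1 + 1 * (t - 1)) - 1 * (φ t).toReal)) := by
      have : Continuous (fun a : ℝ => s * (1 + a * (t - 1)) - a * (φ t).toReal) := by fun_prop
      exact this.continuousWithinAt
    have ht' : c < s * (1 + 1 * (t - 1)) - 1 * (φ t).toReal := by
      convert ht using 2 <;> ring
    obtain ⟨b, hb, hbs⟩ := (mem_nhdsLT_iff_exists_Ioo_subset' (show (0 : ℝ) < 1 by norm_num)).1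
      (hlim.eventually (lt_mem_nhds ht'))
    -- a rational point strictly between `1` and `t`, with parameter in `(max b 0, 1)`
    have hb' : max b 0 < 1 := max_lt hb one_pos
    have hq : ∃ q : ℚ, ∃ a : ℝ, max b 0 < a ∧ a < 1 ∧ (q : ℝ) = 1 + a * (t - 1) := by
      rcases lt_or_gt_of_ne ht1 with hlt | hlt
      · obtain ⟨q, hq1, hq2⟩ := exists_rat_btwn
          (show 1 + 1 * (t - 1) < 1 + max b 0 * (t - 1) by nlinarith)
        have hneg : t - 1 < 0 := by linarith
        refine ⟨q, (q - 1) / (t - 1), ?_, ?_, ?_⟩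
        · rw [lt_div_iff_of_neg hneg]; linarith
        · rw [div_lt_iff_of_neg hneg]; linarith
        · field_simp [hneg.ne]; ring
      · obtain ⟨q, hq1, hq2⟩ := exists_rat_btwn
          (show 1 + max b 0 * (t - 1) < 1 + 1 * (t - 1) by nlinarith)
        have hpos : 0 < t - 1 := by linarith
        refine ⟨q, (q - 1) / (t - 1), ?_, ?_, ?_⟩
        · rw [lt_div_iff₀ hpos]; linarith
        · rw [div_lt_iff₀ hpos]; linarith
        · field_simp; ring
    obtain ⟨q, a, ha, ha1, hqa⟩ := hq
    have ha0 : 0 < a := (le_max_right _ _).trans_lt ha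
    have hle := h.map_segment_one_le t ha0.le ha1.le
    have hφq : φ q ≠ ∞ := by
      rw [hqa]
      exact ne_top_of_le_ne_top (by finiteness) hle
    refine ⟨q, ?_, hφq, ?_⟩
    · have : (0 : ℝ) < q := by rw [hqa]; nlinarith
      exact_mod_cast this
    · have h1 : c < s * (1 + a * (t - 1)) - a * (φ t).toReal :=
        hbs ⟨(le_max_left _ _).trans_lt ha, ha1⟩
      have h2 := ENNReal.toReal_mono (by finiteness) hle
      rw [ENNReal.toReal_mul, ENNReal.toReal_ofReal ha0.le] at h2
      rw [hqa]
      linarith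

/-! ### The dual integrand and the pointwise Lagrangian -/

section Integrand

variable {φ₁ φ₂ φ₃ : ℝ → ℝ≥0∞}

theorem le_perspConj (h₃ : IsDivergenceFunction φ₃) {lam : ℝ≥0} {z : EReal} {z' u : ℝ}
    (hz : (z' : EReal) ≤ z) (hu : φ₃ u ≠ ∞) :
    ((u * z' - lam * (φ₃ u).toReal : ℝ) : EReal) ≤ perspConj φ₃ lam z := by
  have hu0 := h₃.nonneg_of_ne_top hu
  unfold perspConj
  split_ifs with hl hz0
  · have : z' ≤ 0 := by exact_mod_cast hz.trans hz0
    have h' : u * z' - lam * (φ₃ u).toReal ≤ 0 := by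
      rw [hl]; simpa using mul_nonpos_of_nonneg_of_nonpos hu0 this
    exact_mod_cast h'
  · exact le_top
  · have hl0 : 0 < (lam : ℝ) := by positivity
    have hl' : (0 : EReal) < ((lam : ℝ) : EReal) := by exact_mod_cast hl0
    have h1 : ((z' / lam : ℝ) : EReal) ≤ z / ((lam : ℝ) : EReal) := by
      rw [EReal.coe_div]
      exact EReal.div_le_div_right_of_nonneg hl'.le hz
    have h2 := mul_le_mul_of_nonneg_left (le_conj h1 hu0 hu) hl'.le
    rw [← EReal.coe_mul] at h2
    convert h2 using 2
    field_simp

/-- The Fenchel inequality for the composed integrand: it dominates the Lagrangian at the densities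
`u = dP/dP₀`, `t = dQ/dP`, `τ = dQ'/dQ`. The finiteness of `φ₂ t` and `φ₁ τ` is only needed where
these values carry mass. -/
theorem le_gammaStar (h₁ : IsDivergenceFunction φ₁) (h₂ : IsDivergenceFunction φ₂)
    (h₃ : IsDivergenceFunction φ₃) (x θ₁ θ₂ θ₃ : ℝ) (lam : ℝ≥0) {u t τ : ℝ} (hu : φ₃ u ≠ ∞)
    (ht : u ≠ 0 → φ₂ t ≠ ∞) (hτ : u ≠ 0 → t ≠ 0 → φ₁ τ ≠ ∞) :
    ((u * (θ₁ + t * (θ₂ + τ * (θ₃ - x) - (φ₁ τ).toReal) - (φ₂ t).toReal)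
      - lam * (φ₃ u).toReal : ℝ) : EReal) ≤ gammaStar φ₁ φ₂ φ₃ x θ₁ θ₂ θ₃ lam := by
  -- where a density vanishes, the next one is irrelevant and may be taken to be `1`
  wlog hu0 : u ≠ 0 generalizing t τ
  · obtain rfl : u = 0 := not_not.1 hu0
    have h1 : ((θ₃ - x + θ₂ : ℝ) : EReal) ≤ conj φ₁ ((θ₃ - x : ℝ) : EReal) + (θ₂ : EReal) := by
      rw [EReal.coe_add]
      gcongr
      exact le_conj_self h₁ le_rfl
    have h2 := add_le_add_left (le_conj_self h₂ h1) (θ₁ : EReal)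
    rw [← EReal.coe_add] at h2
    refine le_trans (EReal.coe_le_coe_iff.2 (le_of_eq ?_)) (le_perspConj h₃ h2 hu)
    ring
  wlog ht0 : t ≠ 0 generalizing τ
  · obtain rfl : t = 0 := not_not.1 ht0
    have h1 : ((θ₃ - x + θ₂ : ℝ) : EReal) ≤ conj φ₁ ((θ₃ - x : ℝ) : EReal) + (θ₂ : EReal) := by
      rw [EReal.coe_add]
      gcongr
      exact le_conj_self h₁ le_rfl
    have h2 := add_le_add_left (le_conj h1 le_rfl (ht hu0)) (θ₁ : EReal)
    rw [← EReal.coe_add] at h2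
    refine le_trans (EReal.coe_le_coe_iff.2 (le_of_eq ?_)) (le_perspConj h₃ h2 hu)
    ring
  have h1 := add_le_add_left
    (le_conj (s := ((θ₃ - x : ℝ) : EReal)) le_rfl (h₁.nonneg_of_ne_top (hτ hu0 ht0)) (hτ hu0 ht0))
    (θ₂ : EReal)
  rw [← EReal.coe_add] at h1
  have h2 := add_le_add_left (le_conj h1 (h₂.nonneg_of_ne_top (ht hu0)) (ht hu0)) (θ₁ : EReal)
  rw [← EReal.coe_add] at h2
  refine le_trans (EReal.coe_le_coe_iff.2 (le_of_eq ?_)) (le_perspConj h₃ h2 hu)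
  ring

/-- The pointwise gain `-w x - v φ₁(w/v) - u φ₂(v/u)` of densities `u`, `v`, `w` of `P`, `Q`, `Q'`
with respect to `P₀`, at a point where the position takes the value `x`. -/
noncomputable def gain (φ₁ φ₂ : ℝ → ℝ≥0∞) (x u v w : ℝ) : ℝ :=
  -(w * x) - v * (φ₁ (w / v)).toReal - u * (φ₂ (v / u)).toReal

/-- The pointwise Lagrangian: the gain with the moments of the densities and the divergence of `P`
priced at `θ₁`, `θ₂`, `θ₃` and `lam`. -/
noncomputable def lagrangian (φ₁ φ₂ φ₃ : ℝ → ℝ≥0∞) (θ₁ θ₂ θ₃ lam x u v w : ℝ) : ℝ :=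
  gain φ₁ φ₂ x u v w + θ₁ * u + θ₂ * v + θ₃ * w - lam * (φ₃ u).toReal

theorem lagrangian_le_gammaStar (h₁ : IsDivergenceFunction φ₁) (h₂ : IsDivergenceFunction φ₂)
    (h₃ : IsDivergenceFunction φ₃) (x θ₁ θ₂ θ₃ : ℝ) (lam : ℝ≥0) {u v w : ℝ} (hu : 0 < u)
    (hv : 0 < v) (hφu : φ₃ u ≠ ∞) (hφv : φ₂ (v / u) ≠ ∞) (hφw : φ₁ (w / v) ≠ ∞) :
    (lagrangian φ₁ φ₂ φ₃ θ₁ θ₂ θ₃ lam x u v w : EReal)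
      ≤ gammaStar φ₁ φ₂ φ₃ x θ₁ θ₂ θ₃ lam := by
  refine le_trans (EReal.coe_le_coe_iff.2 (le_of_eq ?_))
    (le_gammaStar h₁ h₂ h₃ x θ₁ θ₂ θ₃ lam hφu (fun _ => hφv) (fun _ _ => hφw))
  unfold lagrangian gain
  field_simp
  ring

/-- For `lam > 0` the composed integrand is the supremum of the Lagrangian over a countable set of
positive densities that does not depend on `x`. -/
theorem exists_rat_lt_lagrangian (h₁ : IsDivergenceFunction φ₁) (h₂ : IsDivergenceFunction φ₂)
    (h₃ : IsDivergenceFunction φ₃) (x θ₁ θ₂ θ₃ : ℝ) {lam : ℝ≥0} (hlam : lam ≠ 0) {c : ℝ}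
    (hc : (c : EReal) < gammaStar φ₁ φ₂ φ₃ x θ₁ θ₂ θ₃ lam) :
    ∃ u v w : ℚ, 0 < u ∧ 0 < v ∧ 0 < w ∧ φ₃ u ≠ ∞ ∧ φ₂ (v / u) ≠ ∞ ∧ φ₁ (w / v) ≠ ∞ ∧
      c < lagrangian φ₁ φ₂ φ₃ θ₁ θ₂ θ₃ lam x u v w := by
  have hl0 : 0 < (lam : ℝ) := by positivity
  have hl' : (0 : EReal) < ((lam : ℝ) : EReal) := by exact_mod_cast hl0
  have hltop : ((lam : ℝ) : EReal) ≠ ⊤ := EReal.coe_ne_top _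
  set A := conj φ₁ ((θ₃ - x : ℝ) : EReal) with hA
  have hAge : ((θ₃ - x : ℝ) : EReal) ≤ A := le_conj_self h₁ le_rfl
  have hBge : ((θ₃ - x + θ₂ : ℝ) : EReal) ≤ A + θ₂ := by rw [EReal.coe_add]; gcongr
  have hCge : ((θ₃ - x + θ₂ + θ₁ : ℝ) : EReal) ≤ conj φ₂ (A + θ₂) + θ₁ := by
    rw [EReal.coe_add]; gcongr; exact le_conj_self h₂ hBge
  have hbot : ∀ {a : ℝ} {z : EReal}, (a : EReal) ≤ z → z ≠ ⊥ := fun h h' =>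
    absurd (h' ▸ h) (not_le.2 (EReal.bot_lt_coe _))
  rw [gammaStar, perspConj, if_neg hlam] at hc
  have hc' : ((c / lam : ℝ) : EReal)
      < conj φ₃ ((conj φ₂ (A + θ₂) + θ₁) / ((lam : ℝ) : EReal)) := by
    rw [EReal.coe_div, EReal.div_lt_iff hl' hltop, mul_comm]
    exact hc
  obtain ⟨q₃, hq₃, hφ₃, s₃, hs₃, hc₃⟩ := exists_rat_lt_of_lt_conj h₃ (by
    have : ((((θ₃ - x + θ₂ + θ₁) / lam : ℝ)) : EReal)
        ≤ (conj φ₂ (A + θ₂) + θ₁) / ((lam : ℝ) : EReal) := by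
      rw [EReal.coe_div]; exact EReal.div_le_div_right_of_nonneg hl'.le hCge
    exact hbot this) hc'
  rw [EReal.lt_div_iff hl' hltop, ← EReal.coe_mul] at hs₃
  have hs₃' : ((s₃ * lam - θ₁ : ℝ) : EReal) < conj φ₂ (A + θ₂) := by
    rw [EReal.coe_sub]
    exact EReal.sub_lt_of_lt_add hs₃
  obtain ⟨q₂, hq₂, hφ₂, s₂, hs₂, hc₂⟩ := exists_rat_lt_of_lt_conj h₂ (hbot hBge) hs₃'
  have hs₂' : ((s₂ - θ₂ : ℝ) : EReal) < A := by
    rw [EReal.coe_sub]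
    exact EReal.sub_lt_of_lt_add hs₂
  obtain ⟨q₁, hq₁, hφ₁, s₁, hs₁, hc₁⟩ := exists_rat_lt_of_lt_conj h₁ (EReal.coe_ne_bot _) hs₂'
  have hs₁' : s₁ < θ₃ - x := EReal.coe_lt_coe_iff.1 hs₁
  have p₁ : (0 : ℝ) < q₁ := by exact_mod_cast hq₁
  have p₂ : (0 : ℝ) < q₂ := by exact_mod_cast hq₂
  have p₃ : (0 : ℝ) < q₃ := by exact_mod_cast hq₃
  have e₂ : ((q₃ * q₂ : ℚ) : ℝ) / q₃ = q₂ := by push_cast; field_simp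
  have e₁ : ((q₃ * q₂ * q₁ : ℚ) : ℝ) / (q₃ * q₂ : ℚ) = q₁ := by push_cast; field_simp
  refine ⟨q₃, q₃ * q₂, q₃ * q₂ * q₁, hq₃, by positivity, by positivity, hφ₃, by rwa [e₂],
    by rwa [e₁], ?_⟩
  unfold lagrangian gain
  rw [e₁, e₂]
  push_cast
  have k₁ : s₂ - θ₂ < (θ₃ - x) * q₁ - (φ₁ q₁).toReal := hc₁.trans (by gcongr)
  have k₂ : s₃ * lam - θ₁ < ((θ₃ - x) * q₁ - (φ₁ q₁).toReal + θ₂) * q₂ - (φ₂ q₂).toReal :=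
    hc₂.trans (by gcongr; linarith)
  have k₃ : c < lam * (s₃ * q₃ - (φ₃ q₃).toReal) := by
    rwa [div_lt_iff₀' hl0] at hc₃
  have k₄ : s₃ * lam * q₃
      < (((θ₃ - x) * q₁ - (φ₁ q₁).toReal + θ₂) * q₂ - (φ₂ q₂).toReal + θ₁) * q₃ := by
    gcongr; linarith
  linarith

end Integrand

variable {Ω : Type*} [MeasurableSpace Ω]

/-! ### Expectations of extended-real random variables -/

theorem integrable_of_lintegral_ofReal_ne_top {μ : Measure Ω} {Y : Ω → ℝ} (hY : Measurable Y)
    (h : ∫⁻ ω, ENNReal.ofReal (Y ω) ∂μ ≠ ∞) (h' : ∫⁻ ω, ENNReal.ofReal (-Y ω) ∂μ ≠ ∞) :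
    Integrable Y μ := by
  refine ⟨hY.aestronglyMeasurable, ?_⟩
  have : ∀ ω, ‖Y ω‖ₑ = ENNReal.ofReal (Y ω) + ENNReal.ofReal (-Y ω) := by
    intro ω
    rw [Real.enorm_eq_ofReal_abs]
    rcases le_total 0 (Y ω) with h0 | h0
    · rw [abs_of_nonneg h0, ENNReal.ofReal_of_nonpos (neg_nonpos.2 h0), add_zero]
    · rw [abs_of_nonpos h0, ENNReal.ofReal_of_nonpos h0, zero_add]
  rw [HasFiniteIntegral]
  simp_rw [this]
  rw [lintegral_add_left hY.ennreal_ofReal]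
  exact ENNReal.add_lt_top.2 ⟨h.lt_top, h'.lt_top⟩

theorem integrable_and_integral_eq_toReal {μ : Measure Ω} {Y : Ω → ℝ} (hY : Measurable Y)
    (h0 : ∀ ω, 0 ≤ Y ω) (h : ∫⁻ ω, ENNReal.ofReal (Y ω) ∂μ ≠ ∞) :
    Integrable Y μ ∧ ∫ ω, Y ω ∂μ = (∫⁻ ω, ENNReal.ofReal (Y ω) ∂μ).toReal := by
  refine ⟨integrable_of_lintegral_ofReal_ne_top hY h ?_,
    integral_eq_lintegral_of_nonneg_ae (Filter.Eventually.of_forall h0) hY.aestronglyMeasurable⟩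
  simp [ENNReal.ofReal_of_nonpos, h0]

theorem expectation_congr {μ : Measure Ω} {Y Z : Ω → EReal} (h : Y =ᵐ[μ] Z) :
    expectation μ Y = expectation μ Z := by
  unfold expectation
  congr 2
  · exact lintegral_congr_ae (h.fun_comp EReal.toENNReal)
  · exact lintegral_congr_ae (h.fun_comp fun y => (-y).toENNReal)

theorem expectation_coe_eq (μ : Measure Ω) (Y : Ω → ℝ) :
    expectation μ (fun ω => (Y ω : EReal)) =
      ((∫⁻ ω, ENNReal.ofReal (Y ω) ∂μ : ℝ≥0∞) : EReal)
        - ((∫⁻ ω, ENNReal.ofReal (-Y ω) ∂μ : ℝ≥0∞) : EReal) := by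
  simp only [expectation, ← EReal.coe_neg, EReal.real_coe_toENNReal]

theorem expectation_coe {μ : Measure Ω} {Y : Ω → ℝ} (hY : Integrable Y μ) :
    expectation μ (fun ω => (Y ω : EReal)) = ((∫ ω, Y ω ∂μ : ℝ) : EReal) := by
  rw [expectation_coe_eq, integral_eq_lintegral_pos_part_sub_lintegral_neg_part hY, EReal.coe_sub,
    EReal.coe_ennreal_toReal, EReal.coe_ennreal_toReal]
  · exact hY.neg.lintegral_lt_top.ne
  · exact hY.lintegral_lt_top.ne

theorem expectation_coe_le {μ : Measure Ω} {Y Z : Ω → ℝ} (hY : Measurable Y)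
    (hZ : Integrable Z μ) (hle : Y ≤ᵐ[μ] Z) :
    expectation μ (fun ω => (Y ω : EReal)) ≤ ((∫ ω, Z ω ∂μ : ℝ) : EReal) := by
  have hpos : ∫⁻ ω, ENNReal.ofReal (Y ω) ∂μ ≠ ∞ :=
    ne_top_of_le_ne_top hZ.lintegral_lt_top.ne
      (lintegral_mono_ae (hle.mono fun ω h => ENNReal.ofReal_le_ofReal h))
  by_cases hneg : ∫⁻ ω, ENNReal.ofReal (-Y ω) ∂μ = ∞
  · rw [expectation_coe_eq, hneg, EReal.coe_ennreal_top, EReal.sub_top]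
    exact bot_le
  · have hint := integrable_of_lintegral_ofReal_ne_top hY hpos hneg
    rw [expectation_coe hint]
    exact EReal.coe_le_coe_iff.2 (integral_mono_ae hint hZ hle)

/-- Bounded below by an integrable function and of expectation `< ∞`, an extended-real random
variable is almost surely finite and integrable. -/
theorem exists_integrable_of_expectation_ne_top {μ : Measure Ω} {g : Ω → EReal} {l : Ω → ℝ}
    (hg : Measurable g) (hl : Integrable l μ) (hle : ∀ ω, (l ω : EReal) ≤ g ω)
    (htop : expectation μ g ≠ ⊤) :
    ∃ G : Ω → ℝ, Integrable G μ ∧ (∀ᵐ ω ∂μ, g ω = G ω) ∧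
      expectation μ g = ((∫ ω, G ω ∂μ : ℝ) : EReal) := by
  have hneg : ∫⁻ ω, (-g ω).toENNReal ∂μ ≠ ∞ := by
    refine ne_top_of_le_ne_top hl.neg.lintegral_lt_top.ne (lintegral_mono fun ω => ?_)
    rw [← EReal.real_coe_toENNReal]
    exact EReal.toENNReal_le_toENNReal (by simpa using hle ω)
  have hpos : ∫⁻ ω, (g ω).toENNReal ∂μ ≠ ∞ := by
    intro h
    apply htop
    rw [expectation, h, ← EReal.coe_ennreal_toReal hneg]
    rfl
  have hmem : ∀ᵐ ω ∂μ, g ω = ((g ω).toReal : EReal) := by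
    filter_upwards [ae_lt_top (by fun_prop) hpos] with ω hω
    refine (EReal.coe_toReal ?_ ?_).symm
    · exact EReal.toENNReal_ne_top_iff.1 hω.ne
    · exact ((EReal.bot_lt_coe _).trans_le (hle ω)).ne'
  have hint : Integrable (fun ω => (g ω).toReal) μ := by
    refine integrable_of_lintegral_ofReal_ne_top hg.ereal_toReal ?_ ?_
    · convert hpos using 1
      refine lintegral_congr_ae (hmem.mono fun ω h => ?_)
      beta_reduce
      rw [h]; simp
    · convert hneg using 1
      refine lintegral_congr_ae (hmem.mono fun ω h => ?_)
      beta_reduce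
      rw [h, ← EReal.coe_neg]; simp
  exact ⟨_, hint, hmem, by rw [expectation_congr hmem, expectation_coe hint]⟩

theorem expectation_eq_of_density {μ ν : Measure Ω} {w : Ω → ℝ} (hw : ∀ ω, 0 ≤ w ω)
    (h : ∀ f : Ω → ℝ≥0∞, Measurable f → ∫⁻ ω, f ω ∂ν = ∫⁻ ω, ENNReal.ofReal (w ω) * f ω ∂μ)
    {Y : Ω → ℝ} (hY : Measurable Y) :
    expectation ν (fun ω => (Y ω : EReal)) = expectation μ (fun ω => ((w ω * Y ω : ℝ) : EReal)) := by
  rw [expectation_coe_eq, expectation_coe_eq, h _ (by fun_prop), h _ (by fun_prop)]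
  simp_rw [← mul_neg, ENNReal.ofReal_mul (hw _)]

theorem lintegral_eq_lintegral_ofReal_rnDeriv_mul {μ ν : Measure Ω} [IsFiniteMeasure μ]
    [IsFiniteMeasure ν] (h : μ ≪ ν) {f : Ω → ℝ≥0∞} (hf : Measurable f) :
    ∫⁻ ω, f ω ∂μ = ∫⁻ ω, ENNReal.ofReal (μ.rnDeriv ν ω).toReal * f ω ∂ν := by
  rw [← lintegral_rnDeriv_mul h hf.aemeasurable]
  refine lintegral_congr_ae ?_
  filter_upwards [μ.rnDeriv_lt_top ν] with ω hω
  rw [ENNReal.ofReal_toReal hω.ne]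

/-! ### Weak duality -/

section WeakDuality

variable {φ₁ φ₂ φ₃ : ℝ → ℝ≥0∞}

theorem IsDivergenceFunction.monotone_conj {φ : ℝ → ℝ≥0∞} (h : IsDivergenceFunction φ) :
    Monotone (conj φ) := by
  refine fun s s' hs => iSup_mono fun t => ?_
  by_cases ht : φ t = ∞
  · simp [ht]
  · have : (0 : EReal) ≤ (t : EReal) := by exact_mod_cast h.nonneg_of_ne_top ht
    exact EReal.sub_le_sub (mul_le_mul_of_nonneg_right hs this) le_rfl

theorem IsDivergenceFunction.monotone_perspConj {φ : ℝ → ℝ≥0∞} (h : IsDivergenceFunction φ)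
    (lam : ℝ≥0) : Monotone (perspConj φ lam) := by
  intro s s' hs
  unfold perspConj
  have h0 : (0 : EReal) ≤ ((lam : ℝ) : EReal) := by exact_mod_cast lam.2
  by_cases hl : lam = 0
  · simp only [if_pos hl]
    split_ifs with h1 h2 h2
    · exact le_rfl
    · exact le_top
    · exact absurd (hs.trans h2) h1
    · exact le_rfl
  · simp only [if_neg hl]
    exact mul_le_mul_of_nonneg_left
      (h.monotone_conj (EReal.div_le_div_right_of_nonneg h0 hs)) h0

theorem measurable_gammaStar (h₁ : IsDivergenceFunction φ₁) (h₂ : IsDivergenceFunction φ₂)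
    (h₃ : IsDivergenceFunction φ₃) (θ₁ θ₂ θ₃ : ℝ) (lam : ℝ≥0) :
    Measurable fun x => gammaStar φ₁ φ₂ φ₃ x θ₁ θ₂ θ₃ lam := by
  refine Antitone.measurable fun x y hxy => h₃.monotone_perspConj lam ?_
  refine add_le_add_left (h₂.monotone_conj (add_le_add_left (h₁.monotone_conj ?_) _)) _
  exact EReal.coe_le_coe_iff.2 (by linarith)

theorem const_sub_le_gammaStar (h₁ : IsDivergenceFunction φ₁) (h₂ : IsDivergenceFunction φ₂)
    (h₃ : IsDivergenceFunction φ₃) (x θ₁ θ₂ θ₃ : ℝ) (lam : ℝ≥0) :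
    ((θ₁ + θ₂ + θ₃ - x : ℝ) : EReal) ≤ gammaStar φ₁ φ₂ φ₃ x θ₁ θ₂ θ₃ lam := by
  have := le_gammaStar h₁ h₂ h₃ x θ₁ θ₂ θ₃ lam (u := 1) (t := 1) (τ := 1)
    (by simp [h₃.map_one]) (by simp [h₂.map_one]) (by simp [h₁.map_one])
  refine le_trans (EReal.coe_le_coe_iff.2 (le_of_eq ?_)) this
  simp only [h₁.map_one, h₂.map_one, h₃.map_one, ENNReal.toReal_zero]
  ring

/-- Weak duality: integrate the pointwise Fenchel inequality against `P₀`. -/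
theorem objective_le_dual {P₀ : Measure Ω} [IsProbabilityMeasure P₀] {X : Ω → ℝ}
    (hX : Measurable X) (hXi : Integrable X P₀)
    (h₁ : IsDivergenceFunction φ₁) (m₁ : Measurable φ₁)
    (h₂ : IsDivergenceFunction φ₂) (m₂ : Measurable φ₂)
    (h₃ : IsDivergenceFunction φ₃) (m₃ : Measurable φ₃) {r : ℝ} (hr : 0 ≤ r)
    (θ₁ θ₂ θ₃ : ℝ) (lam : ℝ≥0) {P Q Q' : Measure Ω} [IsProbabilityMeasure P]
    [IsProbabilityMeasure Q] [IsProbabilityMeasure Q']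
    (hP : divergence φ₃ P P₀ ≤ ENNReal.ofReal r) (hQ : Q ≪ P) (hQ' : Q' ≪ Q) :
    expectation Q' (fun ω => ((-X ω : ℝ) : EReal))
        - (divergence φ₁ Q' Q : EReal) - (divergence φ₂ Q P : EReal)
      ≤ ((-θ₁ - θ₂ - θ₃ + (lam : ℝ) * r : ℝ) : EReal)
        + expectation P₀ (fun ω => gammaStar φ₁ φ₂ φ₃ (X ω) θ₁ θ₂ θ₃ lam) := by
  by_cases hD1 : divergence φ₁ Q' Q = ∞
  · rw [hD1, EReal.coe_ennreal_top, EReal.sub_top, EReal.bot_sub]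
    exact bot_le
  by_cases hD2 : divergence φ₂ Q P = ∞
  · rw [hD2, EReal.coe_ennreal_top, EReal.sub_top]
    exact bot_le
  by_cases htop : expectation P₀ (fun ω => gammaStar φ₁ φ₂ φ₃ (X ω) θ₁ θ₂ θ₃ lam) = ⊤
  · rw [htop, EReal.coe_add_top]
    exact le_top
  have hPP : P ≪ P₀ := by
    by_contra h
    rw [divergence, if_neg h] at hP
    exact absurd hP (by simp)
  obtain ⟨G, hG, hgG, hEG⟩ := exists_integrable_of_expectation_ne_top
    ((measurable_gammaStar h₁ h₂ h₃ θ₁ θ₂ θ₃ lam).comp hX)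
    (((integrable_const (θ₁ + θ₂ + θ₃)).sub hXi))
    (fun ω => const_sub_le_gammaStar h₁ h₂ h₃ (X ω) θ₁ θ₂ θ₃ lam) htop
  set u : Ω → ℝ := fun ω => (P.rnDeriv P₀ ω).toReal with hu
  set t : Ω → ℝ := fun ω => (Q.rnDeriv P ω).toReal with ht
  set τ : Ω → ℝ := fun ω => (Q'.rnDeriv Q ω).toReal with hτ
  have mu : Measurable u := (Measure.measurable_rnDeriv _ _).ennreal_toReal
  have mt : Measurable t := (Measure.measurable_rnDeriv _ _).ennreal_toReal
  have mτ : Measurable τ := (Measure.measurable_rnDeriv _ _).ennreal_toReal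
  have u0 : ∀ ω, 0 ≤ u ω := fun _ => ENNReal.toReal_nonneg
  have t0 : ∀ ω, 0 ≤ t ω := fun _ => ENNReal.toReal_nonneg
  have τ0 : ∀ ω, 0 ≤ τ ω := fun _ => ENNReal.toReal_nonneg
  -- integration against `P`, `Q`, `Q'`, all rewritten under `P₀`
  have IP : ∀ f : Ω → ℝ≥0∞, Measurable f →
      ∫⁻ ω, f ω ∂P = ∫⁻ ω, ENNReal.ofReal (u ω) * f ω ∂P₀ := fun f hf =>
    lintegral_eq_lintegral_ofReal_rnDeriv_mul hPP hf
  have IQ : ∀ f : Ω → ℝ≥0∞, Measurable f →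
      ∫⁻ ω, f ω ∂Q = ∫⁻ ω, ENNReal.ofReal (u ω * t ω) * f ω ∂P₀ := by
    intro f hf
    rw [lintegral_eq_lintegral_ofReal_rnDeriv_mul hQ hf, IP _ (by fun_prop)]
    simp_rw [ENNReal.ofReal_mul (u0 _), mul_assoc, ht]
  have IQ' : ∀ f : Ω → ℝ≥0∞, Measurable f →
      ∫⁻ ω, f ω ∂Q' = ∫⁻ ω, ENNReal.ofReal (u ω * t ω * τ ω) * f ω ∂P₀ := by
    intro f hf
    rw [lintegral_eq_lintegral_ofReal_rnDeriv_mul hQ' hf, IQ _ (by fun_prop)]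
    simp_rw [ENNReal.ofReal_mul (mul_nonneg (u0 _) (t0 _)), mul_assoc, hτ]
  -- the divergences as integrals against `P₀`
  have e3 : divergence φ₃ P P₀ = ∫⁻ ω, φ₃ (u ω) ∂P₀ := by rw [divergence, if_pos hPP]
  have e2 : divergence φ₂ Q P = ∫⁻ ω, ENNReal.ofReal (u ω) * φ₂ (t ω) ∂P₀ := by
    rw [divergence, if_pos hQ, ← IP _ (by fun_prop)]
  have e1 : divergence φ₁ Q' Q = ∫⁻ ω, ENNReal.ofReal (u ω * t ω) * φ₁ (τ ω) ∂P₀ := by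
    rw [divergence, if_pos hQ', ← IQ _ (by fun_prop)]
  have hD3 : divergence φ₃ P P₀ ≠ ∞ := ne_top_of_le_ne_top ENNReal.ofReal_ne_top hP
  have f3 := ae_lt_top (by fun_prop) (e3 ▸ hD3)
  have f2 := ae_lt_top (by fun_prop) (e2 ▸ hD2)
  have f1 := ae_lt_top (by fun_prop) (e1 ▸ hD1)
  have j3 := integrable_toReal_of_lintegral_ne_top (by fun_prop) (e3 ▸ hD3)
  have j2 := integrable_toReal_of_lintegral_ne_top (by fun_prop) (e2 ▸ hD2)
  have j1 := integrable_toReal_of_lintegral_ne_top (by fun_prop) (e1 ▸ hD1)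
  have k3 := integral_toReal (by fun_prop) f3
  have k2 := integral_toReal (by fun_prop) f2
  have k1 := integral_toReal (by fun_prop) f1
  rw [← e3] at k3
  rw [← e2] at k2
  rw [← e1] at k1
  simp only [ENNReal.toReal_mul, ENNReal.toReal_ofReal (u0 _),
    ENNReal.toReal_ofReal (mul_nonneg (u0 _) (t0 _))] at j2 j1 k2 k1
  have mass : ∀ (μ : Measure Ω) [IsProbabilityMeasure μ] (w : Ω → ℝ), Measurable w →
      (∀ ω, 0 ≤ w ω) → (∀ f : Ω → ℝ≥0∞, Measurable f →
        ∫⁻ ω, f ω ∂μ = ∫⁻ ω, ENNReal.ofReal (w ω) * f ω ∂P₀) →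
      Integrable w P₀ ∧ ∫ ω, w ω ∂P₀ = 1 := by
    intro μ _ w hw hw0 hI
    have h := hI (fun _ => 1) measurable_const
    simp only [lintegral_const, measure_univ, mul_one] at h
    have := integrable_and_integral_eq_toReal hw hw0 (μ := P₀) (by simp [← h])
    rwa [← h, ENNReal.toReal_one] at this
  obtain ⟨iu, Eu⟩ := mass P u mu u0 IP
  obtain ⟨iv, Ev⟩ := mass Q _ (mu.mul mt) (fun ω => mul_nonneg (u0 ω) (t0 ω)) IQ
  obtain ⟨iw, Ew⟩ := mass Q' _ ((mu.mul mt).mul mτ)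
    (fun ω => mul_nonneg (mul_nonneg (u0 ω) (t0 ω)) (τ0 ω)) IQ'
  set R : Ω → ℝ := fun ω => G ω - θ₁ * u ω - θ₂ * (u ω * t ω) - θ₃ * (u ω * t ω * τ ω)
    + lam * (φ₃ (u ω)).toReal + u ω * (φ₂ (t ω)).toReal + u ω * t ω * (φ₁ (τ ω)).toReal with hR
  have i4 := ((hG.sub (iu.const_mul θ₁)).sub (iv.const_mul θ₂)).sub (iw.const_mul θ₃)
  have i5 := i4.add (j3.const_mul (lam : ℝ))
  have iR : Integrable R P₀ := (i5.add j2).add j1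
  have ER : ∫ ω, R ω ∂P₀ = ∫ ω, G ω ∂P₀ - θ₁ - θ₂ - θ₃
      + lam * (divergence φ₃ P P₀).toReal + (divergence φ₂ Q P).toReal
      + (divergence φ₁ Q' Q).toReal := by
    have a1 : ∫ ω, R ω ∂P₀ = _ := integral_add (i5.add j2) j1
    have a2 := integral_add i5 j2
    have a3 := integral_add i4 (j3.const_mul (lam : ℝ))
    have a4 := integral_sub ((hG.sub (iu.const_mul θ₁)).sub (iv.const_mul θ₂)) (iw.const_mul θ₃)
    have a5 := integral_sub (hG.sub (iu.const_mul θ₁)) (iv.const_mul θ₂)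
    have a6 := integral_sub hG (iu.const_mul θ₁)
    simp only [Pi.add_apply, Pi.sub_apply, Pi.mul_apply, integral_const_mul] at a1 a2 a3 a4 a5 a6 Ev Ew
    rw [a1, a2, a3, a4, a5, a6, Eu, Ev, Ew, k3, k2, k1]
    ring
  have hle : (fun ω => u ω * t ω * τ ω * -X ω) ≤ᵐ[P₀] R := by
    filter_upwards [f3, f2, f1, hgG] with ω g3 g2 g1 hω
    have hp := le_gammaStar h₁ h₂ h₃ (X ω) θ₁ θ₂ θ₃ lam (u := u ω) (t := t ω) (τ := τ ω) g3.ne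
      (fun hu' h => by
        rw [h, ENNReal.mul_top (by simpa using lt_of_le_of_ne (u0 ω) (Ne.symm hu'))] at g2
        exact g2.ne rfl)
      (fun hu' ht' h => by
        rw [h, ENNReal.mul_top (by
          simpa using lt_of_le_of_ne (mul_nonneg (u0 ω) (t0 ω)) (mul_ne_zero hu' ht').symm)] at g1
        exact g1.ne rfl)
    have hω' : gammaStar φ₁ φ₂ φ₃ (X ω) θ₁ θ₂ θ₃ lam = G ω := hω
    rw [hω', EReal.coe_le_coe_iff] at hp
    simp only [hR]
    linarith
  have hE := expectation_coe_le (by fun_prop) iR hle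
  rw [expectation_eq_of_density (μ := P₀)
    (fun ω => mul_nonneg (mul_nonneg (u0 ω) (t0 ω)) (τ0 ω)) IQ' (Y := fun ω => -X ω) hX.neg]
  refine (EReal.sub_le_sub (EReal.sub_le_sub hE le_rfl) le_rfl).trans ?_
  rw [show (fun ω => gammaStar φ₁ φ₂ φ₃ (X ω) θ₁ θ₂ θ₃ lam) =
    (fun x => gammaStar φ₁ φ₂ φ₃ x θ₁ θ₂ θ₃ lam) ∘ X from rfl, hEG,
    ← EReal.coe_ennreal_toReal hD1, ← EReal.coe_ennreal_toReal hD2]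
  have hr3 : (divergence φ₃ P P₀).toReal ≤ r := by
    simpa [ENNReal.toReal_ofReal hr] using ENNReal.toReal_mono ENNReal.ofReal_ne_top hP
  have := mul_le_mul_of_nonneg_left hr3 lam.2
  norm_cast
  rw [ER]
  change (lam : ℝ) * _ ≤ lam * r at this
  linarith

end WeakDuality

/-! ### Monotone convergence -/

/-- Monotone convergence for extended-real limits: `g` is the pointwise supremum of the `f n`. -/
theorem expectation_le_of_monotone {μ : Measure Ω} {g : Ω → EReal} {f : ℕ → Ω → ℝ} {K : ℝ}
    (hg : Measurable g) (hmeas : ∀ n, Measurable (f n)) (hint : ∀ n, Integrable (f n) μ)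
    (hmono : Monotone f) (hle : ∀ n ω, (f n ω : EReal) ≤ g ω)
    (hsup : ∀ ω (c : ℝ), (c : EReal) < g ω → ∃ n, c < f n ω)
    (hK : ∀ n, ∫ ω, f n ω ∂μ ≤ K) : expectation μ g ≤ (K : EReal) := by
  have hpos : ∫⁻ ω, (g ω).toENNReal ∂μ ≠ ∞ := by
    have h1 : ∀ ω, (g ω).toENNReal ≤ ⨆ n, ENNReal.ofReal (f n ω) := by
      refine fun ω => le_of_forall_lt fun c hc => ?_
      have hg0 : 0 < g ω := EReal.toENNReal_pos_iff.1 (pos_of_gt hc)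
      have hctop : c ≠ ∞ := hc.ne_top
      have hc' : ((c.toReal : ℝ) : EReal) < g ω := by
        rw [EReal.coe_ennreal_toReal hctop, ← EReal.coe_toENNReal hg0.le]
        exact EReal.coe_ennreal_lt_coe_ennreal_iff.2 hc
      obtain ⟨n, hn⟩ := hsup ω _ hc'
      refine lt_iSup_iff.2 ⟨n, ?_⟩
      rwa [ENNReal.lt_ofReal_iff_toReal_lt hctop]
    have h2 : ∀ n, ∫⁻ ω, ENNReal.ofReal (f n ω) ∂μ
        ≤ ENNReal.ofReal K + ∫⁻ ω, ENNReal.ofReal (-f 0 ω) ∂μ := by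
      intro n
      have hp := (hint n).lintegral_lt_top.ne
      have hn : ∫⁻ ω, ENNReal.ofReal (-f n ω) ∂μ ≠ ∞ := (hint n).neg.lintegral_lt_top.ne
      have hle' : ∫⁻ ω, ENNReal.ofReal (-f n ω) ∂μ ≤ ∫⁻ ω, ENNReal.ofReal (-f 0 ω) ∂μ :=
        lintegral_mono fun ω => ENNReal.ofReal_le_ofReal (neg_le_neg (hmono (Nat.zero_le n) ω))
      refine le_trans ?_ (add_le_add_right hle' _)
      have := integral_eq_lintegral_pos_part_sub_lintegral_neg_part (hint n)
      rw [← ENNReal.ofReal_toReal hn, ← ENNReal.ofReal_toReal hp]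
      refine le_trans (ENNReal.ofReal_le_ofReal ?_) ENNReal.ofReal_add_le
      linarith [hK n]
    have h3 : ∫⁻ ω, ⨆ n, ENNReal.ofReal (f n ω) ∂μ = ⨆ n, ∫⁻ ω, ENNReal.ofReal (f n ω) ∂μ :=
      lintegral_iSup (fun n => (hmeas n).ennreal_ofReal)
        (fun m n hmn ω => ENNReal.ofReal_le_ofReal (hmono hmn ω))
    refine ne_top_of_le_ne_top ?_ ((lintegral_mono h1).trans (h3.le.trans (iSup_le h2)))
    exact ENNReal.add_ne_top.2 ⟨ENNReal.ofReal_ne_top, (hint 0).neg.lintegral_lt_top.ne⟩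
  have htop : expectation μ g ≠ ⊤ := by
    refine ne_top_of_le_ne_top (b := ((∫⁻ ω, (g ω).toENNReal ∂μ : ℝ≥0∞) : EReal)) ?_ ?_
    · simpa using hpos
    · refine (EReal.sub_le_sub le_rfl (EReal.coe_ennreal_nonneg _)).trans ?_
      rw [sub_zero]
  obtain ⟨G, hG, hgG, hE⟩ := exists_integrable_of_expectation_ne_top hg (hint 0) (hle 0) htop
  rw [hE, EReal.coe_le_coe_iff]
  refine le_of_tendsto' (integral_tendsto_of_tendsto_of_monotone hint hG
    (Filter.Eventually.of_forall fun ω m n hmn => hmono hmn ω) ?_) hK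
  filter_upwards [hgG] with ω hω
  refine tendsto_order.2 ⟨fun c hc => ?_, fun c hc => Filter.Eventually.of_forall fun n => ?_⟩
  · obtain ⟨n, hn⟩ := hsup ω c (by rw [hω]; exact_mod_cast hc)
    filter_upwards [Filter.eventually_ge_atTop n] with k hk
    exact hn.trans_le (hmono hk ω)
  · have := hle n ω
    rw [hω, EReal.coe_le_coe_iff] at this
    exact this.trans_lt hc

/-! ### Measures with positive densities -/

theorem divergence_withDensity (φ : ℝ → ℝ≥0∞) {ν : Measure Ω} [SigmaFinite ν] {f : Ω → ℝ}
    (hf : Measurable f) (h0 : ∀ ω, 0 ≤ f ω) :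
    divergence φ (ν.withDensity fun ω => ENNReal.ofReal (f ω)) ν = ∫⁻ ω, φ (f ω) ∂ν := by
  rw [divergence, if_pos (withDensity_absolutelyContinuous _ _)]
  refine lintegral_congr_ae ?_
  filter_upwards [ν.rnDeriv_withDensity hf.ennreal_ofReal] with ω hω
  rw [hω, ENNReal.toReal_ofReal (h0 ω)]

theorem withDensity_ofReal_eq_withDensity_div {μ : Measure Ω} {U V : Ω → ℝ} (hU : Measurable U)
    (hV : Measurable V) (U0 : ∀ ω, 0 < U ω) :
    μ.withDensity (fun ω => ENNReal.ofReal (V ω)) =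
      (μ.withDensity fun ω => ENNReal.ofReal (U ω)).withDensity
        fun ω => ENNReal.ofReal (V ω / U ω) := by
  rw [← withDensity_mul _ (by fun_prop) (by fun_prop)]
  congr 1
  ext ω
  rw [Pi.mul_apply, ← ENNReal.ofReal_mul (U0 ω).le, mul_div_cancel₀ _ (U0 ω).ne']

theorem divergence_withDensity_withDensity {φ : ℝ → ℝ≥0∞} {μ : Measure Ω} {U V : Ω → ℝ}
    [SigmaFinite (μ.withDensity fun ω => ENNReal.ofReal (U ω))]
    (hU : Measurable U) (hV : Measurable V) (hφ : Measurable φ) (U0 : ∀ ω, 0 < U ω)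
    (V0 : ∀ ω, 0 ≤ V ω) (hfin : ∀ ω, φ (V ω / U ω) ≠ ∞)
    (hint : Integrable (fun ω => U ω * (φ (V ω / U ω)).toReal) μ) :
    divergence φ (μ.withDensity fun ω => ENNReal.ofReal (V ω))
        (μ.withDensity fun ω => ENNReal.ofReal (U ω))
      = ENNReal.ofReal (∫ ω, U ω * (φ (V ω / U ω)).toReal ∂μ) := by
  rw [withDensity_ofReal_eq_withDensity_div hU hV U0,
    divergence_withDensity _ (by fun_prop) fun ω => div_nonneg (V0 ω) (U0 ω).le,
    ofReal_integral_eq_lintegral_ofReal hint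
      (.of_forall fun ω => mul_nonneg (U0 ω).le ENNReal.toReal_nonneg),
    lintegral_withDensity_eq_lintegral_mul _ (by fun_prop) (by fun_prop)]
  simp_rw [ENNReal.ofReal_mul (U0 _).le, ENNReal.ofReal_toReal (hfin _), Pi.mul_apply]

theorem isProbabilityMeasure_withDensity_ofReal {μ : Measure Ω} {U : Ω → ℝ} (hU : Integrable U μ)
    (U0 : ∀ ω, 0 ≤ U ω) (h : ∫ ω, U ω ∂μ = 1) :
    IsProbabilityMeasure (μ.withDensity fun ω => ENNReal.ofReal (U ω)) := by
  refine ⟨?_⟩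
  rw [withDensity_apply _ MeasurableSet.univ, setLIntegral_univ, ← ofReal_integral_eq_lintegral_ofReal hU (Filter.Eventually.of_forall U0), h,
    ENNReal.ofReal_one]

/-! ### Convexity of perspectives, and bounded densities -/

/-- The perspective `(v, w) ↦ v φ (w / v)` is convex. -/
theorem IsDivergenceFunction.perspective_convex {φ : ℝ → ℝ≥0∞} (h : IsDivergenceFunction φ)
    {v v' w w' a b : ℝ} (hv : 0 < v) (hv' : 0 < v') (hφ : φ (w / v) ≠ ∞) (hφ' : φ (w' / v') ≠ ∞)
    (ha : 0 ≤ a) (hb : 0 ≤ b) (hab : 0 < a * v + b * v') :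
    (a * v + b * v') * (φ ((a * w + b * w') / (a * v + b * v'))).toReal
      ≤ a * (v * (φ (w / v)).toReal) + b * (v' * (φ (w' / v')).toReal) := by
  have key := h.toReal_convex hφ hφ' (a := a * v / (a * v + b * v'))
    (b := b * v' / (a * v + b * v')) (by positivity) (by positivity) (by field_simp)
  rw [show a * v / (a * v + b * v') * (w / v) + b * v' / (a * v + b * v') * (w' / v')
    = (a * w + b * w') / (a * v + b * v') by field_simp] at key
  refine (mul_le_mul_of_nonneg_left key hab.le).trans (le_of_eq ?_)
  field_simp

theorem IsDivergenceFunction.map_convex_le {φ : ℝ → ℝ≥0∞} (h : IsDivergenceFunction φ)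
    {x y a b : ℝ} {C : ℝ≥0∞} (hx : φ x ≤ C) (hy : φ y ≤ C) (ha : 0 ≤ a) (hb : 0 ≤ b)
    (hab : a + b = 1) : φ (a * x + b * y) ≤ C := by
  refine (h.convex x y a b ha hb hab).trans ?_
  calc ENNReal.ofReal a * φ x + ENNReal.ofReal b * φ y
      ≤ ENNReal.ofReal a * C + ENNReal.ofReal b * C := by gcongr
    _ = C := by rw [← add_mul, ← ENNReal.ofReal_add ha hb, hab, ENNReal.ofReal_one, one_mul]

theorem IsDivergenceFunction.map_div_le {φ : ℝ → ℝ≥0∞} (h : IsDivergenceFunction φ)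
    {v v' w w' a b : ℝ} {C : ℝ≥0∞} (hv : 0 < v) (hv' : 0 < v') (hφ : φ (w / v) ≤ C)
    (hφ' : φ (w' / v') ≤ C) (ha : 0 ≤ a) (hb : 0 ≤ b) (hab : 0 < a * v + b * v') :
    φ ((a * w + b * w') / (a * v + b * v')) ≤ C := by
  have key := h.map_convex_le hφ hφ' (a := a * v / (a * v + b * v'))
    (b := b * v' / (a * v + b * v')) (by positivity) (by positivity) (by field_simp)
  rwa [show a * v / (a * v + b * v') * (w / v) + b * v' / (a * v + b * v') * (w' / v')
    = (a * w + b * w') / (a * v + b * v') by field_simp] at key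

/-- Positive bounded densities `U`, `V`, `W` (not necessarily of mass one) for `P`, `Q`, `Q'`, such
that the divergence integrands are bounded as well. They make up a convex class, stable under
measurable pasting, on which all integrals are finite. -/
structure IsBoundedDensity (φ₁ φ₂ φ₃ : ℝ → ℝ≥0∞) (U V W : Ω → ℝ) : Prop where
  measurable_fst : Measurable U
  measurable_snd : Measurable V
  measurable_thd : Measurable W
  pos_fst : ∀ ω, 0 < U ω
  pos_snd : ∀ ω, 0 < V ω
  pos_thd : ∀ ω, 0 < W ω
  bound : ∃ C : ℝ≥0, ∀ ω, U ω ≤ C ∧ V ω ≤ C ∧ W ω ≤ C ∧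
    φ₃ (U ω) ≤ C ∧ φ₂ (V ω / U ω) ≤ C ∧ φ₁ (W ω / V ω) ≤ C

namespace IsBoundedDensity

variable {φ₁ φ₂ φ₃ : ℝ → ℝ≥0∞} {U V W U' V' W' : Ω → ℝ} {P₀ : Measure Ω} {X : Ω → ℝ}

theorem const {u v w : ℝ} (hu : 0 < u) (hv : 0 < v) (hw : 0 < w) (h3 : φ₃ u ≠ ∞)
    (h2 : φ₂ (v / u) ≠ ∞) (h1 : φ₁ (w / v) ≠ ∞) :
    IsBoundedDensity φ₁ φ₂ φ₃ (fun _ : Ω => u) (fun _ => v) (fun _ => w) := by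
  refine ⟨measurable_const, measurable_const, measurable_const, fun _ => hu, fun _ => hv,
    fun _ => hw, ?_⟩
  obtain ⟨C, hC⟩ := (finite_range ![u, v, w, (φ₃ u).toReal, (φ₂ (v / u)).toReal,
    (φ₁ (w / v)).toReal]).bddAbove
  have hi : ∀ i, ![u, v, w, (φ₃ u).toReal, (φ₂ (v / u)).toReal, (φ₁ (w / v)).toReal] i ≤ C :=
    fun i => hC (mem_range_self i)
  have hCle : C ≤ C.toNNReal := Real.le_coe_toNNReal C
  have hphi : ∀ {x : ℝ≥0∞}, x ≠ ∞ → x.toReal ≤ C → x ≤ (C.toNNReal : ℝ≥0∞) := fun hx hxC =>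
    (ENNReal.le_ofReal_iff_toReal_le hx (ENNReal.toReal_nonneg.trans hxC)).2 hxC
  exact ⟨C.toNNReal, fun _ => ⟨(hi 0).trans hCle, (hi 1).trans hCle, (hi 2).trans hCle,
    hphi h3 (hi 3), hphi h2 (hi 4), hphi h1 (hi 5)⟩⟩

theorem piecewise (h : IsBoundedDensity φ₁ φ₂ φ₃ U V W) (h' : IsBoundedDensity φ₁ φ₂ φ₃ U' V' W')
    {s : Set Ω} (hs : MeasurableSet s) [DecidablePred (· ∈ s)] :
    IsBoundedDensity φ₁ φ₂ φ₃ (s.piecewise U U') (s.piecewise V V') (s.piecewise W W') := by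
  refine ⟨h.measurable_fst.piecewise hs h'.measurable_fst,
    h.measurable_snd.piecewise hs h'.measurable_snd,
    h.measurable_thd.piecewise hs h'.measurable_thd, ?_, ?_, ?_, ?_⟩
  · intro ω; by_cases hω : ω ∈ s <;> simp [hω, h.pos_fst, h'.pos_fst]
  · intro ω; by_cases hω : ω ∈ s <;> simp [hω, h.pos_snd, h'.pos_snd]
  · intro ω; by_cases hω : ω ∈ s <;> simp [hω, h.pos_thd, h'.pos_thd]
  · obtain ⟨C, hC⟩ := h.bound
    obtain ⟨C', hC'⟩ := h'.bound
    refine ⟨max C C', fun ω => ?_⟩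
    by_cases hω : ω ∈ s
    · simpa [hω] using (show _ from by
        obtain ⟨a, b, c, d, e, f⟩ := hC ω
        exact ⟨.inl a, .inl b, .inl c, .inl d, .inl e, .inl f⟩)
    · simpa [hω] using (show _ from by
        obtain ⟨a, b, c, d, e, f⟩ := hC' ω
        exact ⟨.inr a, .inr b, .inr c, .inr d, .inr e, .inr f⟩)

theorem convex_comb (h₁ : IsDivergenceFunction φ₁) (h₂ : IsDivergenceFunction φ₂)
    (h₃ : IsDivergenceFunction φ₃) (h : IsBoundedDensity φ₁ φ₂ φ₃ U V W)
    (h' : IsBoundedDensity φ₁ φ₂ φ₃ U' V' W') {a b : ℝ} (ha : 0 ≤ a) (hb : 0 ≤ b)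
    (hab : a + b = 1) :
    IsBoundedDensity φ₁ φ₂ φ₃ (fun ω => a * U ω + b * U' ω) (fun ω => a * V ω + b * V' ω)
      (fun ω => a * W ω + b * W' ω) := by
  have pos : ∀ {x y : ℝ}, 0 < x → 0 < y → 0 < a * x + b * y := fun hx hy =>
    convex_Ioi (0 : ℝ) hx hy ha hb hab
  have le : ∀ {x y C : ℝ}, x ≤ C → y ≤ C → a * x + b * y ≤ C := fun {_ _ C} hx hy =>
    convex_Iic C hx hy ha hb hab
  refine ⟨(h.measurable_fst.const_mul a).add (h'.measurable_fst.const_mul b),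
    (h.measurable_snd.const_mul a).add (h'.measurable_snd.const_mul b),
    (h.measurable_thd.const_mul a).add (h'.measurable_thd.const_mul b),
    fun ω => pos (h.pos_fst ω) (h'.pos_fst ω), fun ω => pos (h.pos_snd ω) (h'.pos_snd ω),
    fun ω => pos (h.pos_thd ω) (h'.pos_thd ω), ?_⟩
  obtain ⟨C, hC⟩ := h.bound
  obtain ⟨C', hC'⟩ := h'.bound
  refine ⟨max C C', fun ω => ?_⟩
  have l : (C : ℝ) ≤ (max C C' : ℝ≥0) := by exact_mod_cast le_max_left C C'
  have l' : (C' : ℝ) ≤ (max C C' : ℝ≥0) := by exact_mod_cast le_max_right C C'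
  have m : (C : ℝ≥0∞) ≤ (max C C' : ℝ≥0) := by exact_mod_cast le_max_left C C'
  have m' : (C' : ℝ≥0∞) ≤ (max C C' : ℝ≥0) := by exact_mod_cast le_max_right C C'
  obtain ⟨c1, c2, c3, c4, c5, c6⟩ := hC ω
  obtain ⟨d1, d2, d3, d4, d5, d6⟩ := hC' ω
  exact ⟨le (c1.trans l) (d1.trans l'), le (c2.trans l) (d2.trans l'),
    le (c3.trans l) (d3.trans l'), h₃.map_convex_le (c4.trans m) (d4.trans m') ha hb hab,
    h₂.map_div_le (h.pos_fst ω) (h'.pos_fst ω) (c5.trans m) (d5.trans m') ha hb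
      (pos (h.pos_fst ω) (h'.pos_fst ω)),
    h₁.map_div_le (h.pos_snd ω) (h'.pos_snd ω) (c6.trans m) (d6.trans m') ha hb
      (pos (h.pos_snd ω) (h'.pos_snd ω))⟩

theorem finite_fst (h : IsBoundedDensity φ₁ φ₂ φ₃ U V W) (ω : Ω) : φ₃ (U ω) ≠ ∞ := by
  obtain ⟨C, hC⟩ := h.bound
  exact ne_top_of_le_ne_top ENNReal.coe_ne_top (hC ω).2.2.2.1

theorem finite_snd (h : IsBoundedDensity φ₁ φ₂ φ₃ U V W) (ω : Ω) : φ₂ (V ω / U ω) ≠ ∞ := by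
  obtain ⟨C, hC⟩ := h.bound
  exact ne_top_of_le_ne_top ENNReal.coe_ne_top (hC ω).2.2.2.2.1

theorem finite_thd (h : IsBoundedDensity φ₁ φ₂ φ₃ U V W) (ω : Ω) : φ₁ (W ω / V ω) ≠ ∞ := by
  obtain ⟨C, hC⟩ := h.bound
  exact ne_top_of_le_ne_top ENNReal.coe_ne_top (hC ω).2.2.2.2.2

theorem integrable_fst [IsFiniteMeasure P₀] (h : IsBoundedDensity φ₁ φ₂ φ₃ U V W) :
    Integrable U P₀ := by
  obtain ⟨C, hC⟩ := h.bound
  refine .of_bound h.measurable_fst.aestronglyMeasurable C (.of_forall fun ω => ?_)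
  rw [Real.norm_of_nonneg (h.pos_fst ω).le]
  exact (hC ω).1

theorem integrable_snd [IsFiniteMeasure P₀] (h : IsBoundedDensity φ₁ φ₂ φ₃ U V W) :
    Integrable V P₀ := by
  obtain ⟨C, hC⟩ := h.bound
  refine .of_bound h.measurable_snd.aestronglyMeasurable C (.of_forall fun ω => ?_)
  rw [Real.norm_of_nonneg (h.pos_snd ω).le]
  exact (hC ω).2.1

theorem integrable_thd [IsFiniteMeasure P₀] (h : IsBoundedDensity φ₁ φ₂ φ₃ U V W) :
    Integrable W P₀ := by
  obtain ⟨C, hC⟩ := h.bound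
  refine .of_bound h.measurable_thd.aestronglyMeasurable C (.of_forall fun ω => ?_)
  rw [Real.norm_of_nonneg (h.pos_thd ω).le]
  exact (hC ω).2.2.1

theorem integrable_mul [IsFiniteMeasure P₀] (h : IsBoundedDensity φ₁ φ₂ φ₃ U V W)
    (hX : Integrable X P₀) : Integrable (fun ω => W ω * X ω) P₀ := by
  obtain ⟨C, hC⟩ := h.bound
  refine hX.bdd_mul (c := C) h.measurable_thd.aestronglyMeasurable (.of_forall fun ω => ?_)
  rw [Real.norm_of_nonneg (h.pos_thd ω).le]
  exact (hC ω).2.2.1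

theorem integrable_div_fst [IsFiniteMeasure P₀] (h : IsBoundedDensity φ₁ φ₂ φ₃ U V W)
    (m₃ : Measurable φ₃) : Integrable (fun ω => (φ₃ (U ω)).toReal) P₀ := by
  obtain ⟨C, hC⟩ := h.bound
  refine .of_bound (m₃.comp h.measurable_fst).ennreal_toReal.aestronglyMeasurable C
    (.of_forall fun ω => ?_)
  rw [Real.norm_of_nonneg ENNReal.toReal_nonneg]
  exact ENNReal.toReal_mono ENNReal.coe_ne_top (hC ω).2.2.2.1

theorem integrable_div_snd [IsFiniteMeasure P₀] (h : IsBoundedDensity φ₁ φ₂ φ₃ U V W)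
    (m₂ : Measurable φ₂) : Integrable (fun ω => U ω * (φ₂ (V ω / U ω)).toReal) P₀ := by
  obtain ⟨C, hC⟩ := h.bound
  refine h.integrable_fst.mul_bdd (c := C)
    (m₂.comp (h.measurable_snd.div h.measurable_fst)).ennreal_toReal.aestronglyMeasurable
    (.of_forall fun ω => ?_)
  rw [Real.norm_of_nonneg ENNReal.toReal_nonneg]
  exact ENNReal.toReal_mono ENNReal.coe_ne_top (hC ω).2.2.2.2.1

theorem integrable_div_thd [IsFiniteMeasure P₀] (h : IsBoundedDensity φ₁ φ₂ φ₃ U V W)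
    (m₁ : Measurable φ₁) : Integrable (fun ω => V ω * (φ₁ (W ω / V ω)).toReal) P₀ := by
  obtain ⟨C, hC⟩ := h.bound
  refine h.integrable_snd.mul_bdd (c := C)
    (m₁.comp (h.measurable_thd.div h.measurable_snd)).ennreal_toReal.aestronglyMeasurable
    (.of_forall fun ω => ?_)
  rw [Real.norm_of_nonneg ENNReal.toReal_nonneg]
  exact ENNReal.toReal_mono ENNReal.coe_ne_top (hC ω).2.2.2.2.2

theorem integrable_gain [IsFiniteMeasure P₀] (h : IsBoundedDensity φ₁ φ₂ φ₃ U V W)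
    (m₁ : Measurable φ₁) (m₂ : Measurable φ₂) (hX : Integrable X P₀) :
    Integrable (fun ω => gain φ₁ φ₂ (X ω) (U ω) (V ω) (W ω)) P₀ :=
  ((h.integrable_mul hX).neg.sub (h.integrable_div_thd m₁)).sub (h.integrable_div_snd m₂)

theorem gain_concave (h₁ : IsDivergenceFunction φ₁) (h₂ : IsDivergenceFunction φ₂)
    (h : IsBoundedDensity φ₁ φ₂ φ₃ U V W)
    (h' : IsBoundedDensity φ₁ φ₂ φ₃ U' V' W') {a b : ℝ} (ha : 0 ≤ a) (hb : 0 ≤ b)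
    (hab : a + b = 1) (x : ℝ) (ω : Ω) :
    a * gain φ₁ φ₂ x (U ω) (V ω) (W ω) + b * gain φ₁ φ₂ x (U' ω) (V' ω) (W' ω)
      ≤ gain φ₁ φ₂ x (a * U ω + b * U' ω) (a * V ω + b * V' ω) (a * W ω + b * W' ω) := by
  have p1 := h₁.perspective_convex (h.pos_snd ω) (h'.pos_snd ω) (h.finite_thd ω) (h'.finite_thd ω)
    ha hb (convex_Ioi (0 : ℝ) (h.pos_snd ω) (h'.pos_snd ω) ha hb hab)
  have p2 := h₂.perspective_convex (h.pos_fst ω) (h'.pos_fst ω) (h.finite_snd ω) (h'.finite_snd ω)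
    ha hb (convex_Ioi (0 : ℝ) (h.pos_fst ω) (h'.pos_fst ω) ha hb hab)
  unfold gain
  linarith

/-- Bounded densities of mass one that satisfy the divergence constraint give a feasible triple of
measures, whose objective is the integrated gain. -/
theorem integral_gain_le_globalizedOCE [IsProbabilityMeasure P₀]
    (h : IsBoundedDensity φ₁ φ₂ φ₃ U V W) (m₁ : Measurable φ₁) (m₂ : Measurable φ₂)
    (m₃ : Measurable φ₃) (hXm : Measurable X) (hX : Integrable X P₀) {r : ℝ}
    (hU : ∫ ω, U ω ∂P₀ = 1) (hV : ∫ ω, V ω ∂P₀ = 1) (hW : ∫ ω, W ω ∂P₀ = 1)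
    (hr : ∫ ω, (φ₃ (U ω)).toReal ∂P₀ ≤ r) :
    ((∫ ω, gain φ₁ φ₂ (X ω) (U ω) (V ω) (W ω) ∂P₀ : ℝ) : EReal)
      ≤ globalizedOCE φ₁ φ₂ φ₃ r P₀ X := by
  have mU := h.measurable_fst
  have mV := h.measurable_snd
  have mW := h.measurable_thd
  set P := P₀.withDensity fun ω => ENNReal.ofReal (U ω) with hP
  set Q := P₀.withDensity fun ω => ENNReal.ofReal (V ω) with hQ
  set Q' := P₀.withDensity fun ω => ENNReal.ofReal (W ω) with hQ'
  have iP : IsProbabilityMeasure P :=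
    isProbabilityMeasure_withDensity_ofReal h.integrable_fst (fun ω => (h.pos_fst ω).le) hU
  have iQ : IsProbabilityMeasure Q :=
    isProbabilityMeasure_withDensity_ofReal h.integrable_snd (fun ω => (h.pos_snd ω).le) hV
  have iQ' : IsProbabilityMeasure Q' :=
    isProbabilityMeasure_withDensity_ofReal h.integrable_thd (fun ω => (h.pos_thd ω).le) hW
  have d3 : divergence φ₃ P P₀ ≤ ENNReal.ofReal r := by
    rw [hP, divergence_withDensity _ mU fun ω => (h.pos_fst ω).le]
    refine le_trans (le_of_eq ?_) (ENNReal.ofReal_le_ofReal hr)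
    rw [ofReal_integral_eq_lintegral_ofReal (h.integrable_div_fst m₃)
      (.of_forall fun _ => ENNReal.toReal_nonneg)]
    simp_rw [ENNReal.ofReal_toReal (h.finite_fst _)]
  have d2 : divergence φ₂ Q P = ENNReal.ofReal (∫ ω, U ω * (φ₂ (V ω / U ω)).toReal ∂P₀) :=
    divergence_withDensity_withDensity mU mV m₂ h.pos_fst (fun ω => (h.pos_snd ω).le) h.finite_snd
      (h.integrable_div_snd m₂)
  have d1 : divergence φ₁ Q' Q = ENNReal.ofReal (∫ ω, V ω * (φ₁ (W ω / V ω)).toReal ∂P₀) :=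
    divergence_withDensity_withDensity mV mW m₁ h.pos_snd (fun ω => (h.pos_thd ω).le) h.finite_thd
      (h.integrable_div_thd m₁)
  have eE : expectation Q' (fun ω => ((-X ω : ℝ) : EReal))
      = ((-∫ ω, W ω * X ω ∂P₀ : ℝ) : EReal) := by
    rw [expectation_eq_of_density (μ := P₀) (fun ω => (h.pos_thd ω).le) (fun f hf => by
      rw [hQ', lintegral_withDensity_eq_lintegral_mul _ (by fun_prop) hf]; rfl)
      (Y := fun ω => -X ω) hXm.neg]
    simp_rw [mul_neg]
    rw [← integral_neg]
    exact expectation_coe (h.integrable_mul hX).neg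
  have eG : ∫ ω, gain φ₁ φ₂ (X ω) (U ω) (V ω) (W ω) ∂P₀ = -∫ ω, W ω * X ω ∂P₀
      - ∫ ω, V ω * (φ₁ (W ω / V ω)).toReal ∂P₀ - ∫ ω, U ω * (φ₂ (V ω / U ω)).toReal ∂P₀ := by
    have a1 := integral_sub ((h.integrable_mul hX).neg.sub (h.integrable_div_thd m₁))
      (h.integrable_div_snd m₂)
    have a2 := integral_sub (h.integrable_mul hX).neg (h.integrable_div_thd m₁)
    simp only [Pi.sub_apply, Pi.neg_apply, integral_neg] at a1 a2
    unfold gain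
    rw [a1, a2]
  have hval : ((∫ ω, gain φ₁ φ₂ (X ω) (U ω) (V ω) (W ω) ∂P₀ : ℝ) : EReal)
      = expectation Q' (fun ω => ((-X ω : ℝ) : EReal)) - (divergence φ₁ Q' Q : EReal)
        - (divergence φ₂ Q P : EReal) := by
    have n1 : 0 ≤ ∫ ω, V ω * (φ₁ (W ω / V ω)).toReal ∂P₀ :=
      integral_nonneg fun ω => mul_nonneg (h.pos_snd ω).le ENNReal.toReal_nonneg
    have n2 : 0 ≤ ∫ ω, U ω * (φ₂ (V ω / U ω)).toReal ∂P₀ :=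
      integral_nonneg fun ω => mul_nonneg (h.pos_fst ω).le ENNReal.toReal_nonneg
    rw [eE, d1, d2, EReal.coe_ennreal_ofReal, EReal.coe_ennreal_ofReal, max_eq_left n1,
      max_eq_left n2, eG]
    rfl
  rw [hval]
  unfold globalizedOCE
  refine le_iSup_of_le P <| le_iSup_of_le iP <| le_iSup_of_le d3 <| le_iSup_of_le Q <|
    le_iSup_of_le iQ <| le_iSup_of_le ?_ <| le_iSup_of_le Q' <| le_iSup_of_le iQ' <|
    le_iSup_of_le ?_ le_rfl
  · rw [hQ, withDensity_ofReal_eq_withDensity_div mU mV h.pos_fst]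
    exact withDensity_absolutelyContinuous _ _
  · rw [hQ', withDensity_ofReal_eq_withDensity_div mV mW h.pos_snd]
    exact withDensity_absolutelyContinuous _ _

end IsBoundedDensity

/-! ### Strong duality -/

section StrongDuality

variable {φ₁ φ₂ φ₃ : ℝ → ℝ≥0∞} {P₀ : Measure Ω} {X : Ω → ℝ}

/-- The points `((E U, E V, E W, ρ), y)` for which bounded densities `U`, `V`, `W` have divergence at
most `ρ` and integrated gain at least `y`: up to attainment of suprema, the hypograph of the value
function of the primal problem under perturbation of its four constraints. -/
def valueHypograph (φ₁ φ₂ φ₃ : ℝ → ℝ≥0∞) (P₀ : Measure Ω) (X : Ω → ℝ) :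
    Set ((ℝ × ℝ × ℝ × ℝ) × ℝ) :=
  {p | ∃ U V W : Ω → ℝ, IsBoundedDensity φ₁ φ₂ φ₃ U V W ∧ ∫ ω, U ω ∂P₀ = p.1.1 ∧
    ∫ ω, V ω ∂P₀ = p.1.2.1 ∧ ∫ ω, W ω ∂P₀ = p.1.2.2.1 ∧
    ∫ ω, (φ₃ (U ω)).toReal ∂P₀ ≤ p.1.2.2.2 ∧
    p.2 ≤ ∫ ω, gain φ₁ φ₂ (X ω) (U ω) (V ω) (W ω) ∂P₀}

theorem convex_valueHypograph [IsProbabilityMeasure P₀] (hX : Integrable X P₀)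
    (h₁ : IsDivergenceFunction φ₁) (m₁ : Measurable φ₁)
    (h₂ : IsDivergenceFunction φ₂) (m₂ : Measurable φ₂)
    (h₃ : IsDivergenceFunction φ₃) (m₃ : Measurable φ₃) :
    Convex ℝ (valueHypograph φ₁ φ₂ φ₃ P₀ X) := by
  rintro ⟨⟨a, b, c, ρ⟩, y⟩ ⟨U, V, W, h, hU, hV, hW, hρ, hy⟩ ⟨⟨a', b', c', ρ'⟩, y'⟩
    ⟨U', V', W', h', hU', hV', hW', hρ', hy'⟩ s t hs ht hst
  have hh := h.convex_comb h₁ h₂ h₃ h' hs ht hst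
  have lin : ∀ {f g : Ω → ℝ}, Integrable f P₀ → Integrable g P₀ →
      ∫ ω, (s * f ω + t * g ω) ∂P₀ = s * ∫ ω, f ω ∂P₀ + t * ∫ ω, g ω ∂P₀ := by
    intro f g hf hg
    rw [integral_add (hf.const_mul s) (hg.const_mul t), integral_const_mul, integral_const_mul]
  dsimp only at hU hV hW hρ hy hU' hV' hW' hρ' hy'
  refine ⟨_, _, _, hh, ?_, ?_, ?_, ?_, ?_⟩
  · rw [lin h.integrable_fst h'.integrable_fst, hU, hU']; rfl
  · rw [lin h.integrable_snd h'.integrable_snd, hV, hV']; rfl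
  · rw [lin h.integrable_thd h'.integrable_thd, hW, hW']; rfl
  · refine (integral_mono (hh.integrable_div_fst m₃)
      (((h.integrable_div_fst m₃).const_mul s).add ((h'.integrable_div_fst m₃).const_mul t))
      fun ω => h₃.toReal_convex (h.finite_fst ω) (h'.finite_fst ω) hs ht hst).trans ?_
    change ∫ ω, (s * (φ₃ (U ω)).toReal + t * (φ₃ (U' ω)).toReal) ∂P₀ ≤ s * ρ + t * ρ'
    rw [lin (h.integrable_div_fst m₃) (h'.integrable_div_fst m₃)]
    gcongr
  · refine le_trans ?_ (integral_mono (((h.integrable_gain m₁ m₂ hX).const_mul s).add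
      ((h'.integrable_gain m₁ m₂ hX).const_mul t)) (hh.integrable_gain m₁ m₂ hX)
      fun ω => h.gain_concave h₁ h₂ h' hs ht hst (X ω) ω)
    change s * y + t * y' ≤ ∫ ω, (s * gain φ₁ φ₂ (X ω) (U ω) (V ω) (W ω)
      + t * gain φ₁ φ₂ (X ω) (U' ω) (V' ω) (W' ω)) ∂P₀
    rw [lin (h.integrable_gain m₁ m₂ hX) (h'.integrable_gain m₁ m₂ hX)]
    gcongr

/-- The Slater condition: constant densities near `1` have small divergences, so the value function
is bounded below near the point `(1, 1, 1, r)` of the unperturbed problem. -/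
theorem eventually_mem_valueHypograph [IsProbabilityMeasure P₀] (hX : Integrable X P₀)
    (h₁ : IsDivergenceFunction φ₁) (h₂ : IsDivergenceFunction φ₂) (h₃ : IsDivergenceFunction φ₃)
    {r : ℝ} (hr : 0 < r) :
    ∀ᶠ p : ℝ × ℝ × ℝ × ℝ in 𝓝 (1, 1, 1, r),
      (p, -∫ ω, X ω ∂P₀ - 1) ∈ valueHypograph φ₁ φ₂ φ₃ P₀ X := by
  set p₀ : ℝ × ℝ × ℝ × ℝ := (1, 1, 1, r) with hp₀
  have t1 : Filter.Tendsto (fun p : ℝ × ℝ × ℝ × ℝ => p.1) (𝓝 p₀) (𝓝 1) :=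
    continuous_fst.tendsto' _ _ rfl
  have t2 : Filter.Tendsto (fun p : ℝ × ℝ × ℝ × ℝ => p.2.1) (𝓝 p₀) (𝓝 1) :=
    (continuous_fst.comp continuous_snd).tendsto' _ _ rfl
  have t3 : Filter.Tendsto (fun p : ℝ × ℝ × ℝ × ℝ => p.2.2.1) (𝓝 p₀) (𝓝 1) :=
    (continuous_fst.comp (continuous_snd.comp continuous_snd)).tendsto' _ _ rfl
  have t4 : Filter.Tendsto (fun p : ℝ × ℝ × ℝ × ℝ => p.2.2.2) (𝓝 p₀) (𝓝 r) :=
    (continuous_snd.comp (continuous_snd.comp continuous_snd)).tendsto' _ _ rfl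
  have t21 : Filter.Tendsto (fun p : ℝ × ℝ × ℝ × ℝ => p.2.1 / p.1) (𝓝 p₀) (𝓝 1) := by
    simpa using! t2.div t1 one_ne_zero
  have t32 : Filter.Tendsto (fun p : ℝ × ℝ × ℝ × ℝ => p.2.2.1 / p.2.1) (𝓝 p₀) (𝓝 1) := by
    simpa using! t3.div t2 one_ne_zero
  have toReal : ∀ {f : ℝ × ℝ × ℝ × ℝ → ℝ≥0∞}, Filter.Tendsto f (𝓝 p₀) (𝓝 0) →
      Filter.Tendsto (fun p => (f p).toReal) (𝓝 p₀) (𝓝 0) := fun hf =>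
    (ENNReal.tendsto_toReal ENNReal.zero_ne_top).comp hf
  have f3 := h₃.tendsto_one.comp t1
  have f2 := h₂.tendsto_one.comp t21
  have f1 := h₁.tendsto_one.comp t32
  have tg : Filter.Tendsto (fun p : ℝ × ℝ × ℝ × ℝ => -(p.2.2.1 * ∫ ω, X ω ∂P₀)
      - p.2.1 * (φ₁ (p.2.2.1 / p.2.1)).toReal - p.1 * (φ₂ (p.2.1 / p.1)).toReal) (𝓝 p₀)
      (𝓝 (-∫ ω, X ω ∂P₀)) := by
    simpa using (((t3.mul_const (∫ ω, X ω ∂P₀)).neg).sub (t2.mul (toReal f1))).sub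
      (t1.mul (toReal f2))
  filter_upwards [t1.eventually (lt_mem_nhds one_pos), t2.eventually (lt_mem_nhds one_pos),
    t3.eventually (lt_mem_nhds one_pos), f3.eventually (gt_mem_nhds ENNReal.zero_lt_top),
    f2.eventually (gt_mem_nhds ENNReal.zero_lt_top),
    f1.eventually (gt_mem_nhds ENNReal.zero_lt_top),
    (toReal f3).eventually (gt_mem_nhds (half_pos hr)),
    t4.eventually (lt_mem_nhds (half_lt_self hr)),
    tg.eventually (lt_mem_nhds (sub_one_lt _))] with p g1 g2 g3 n3 n2 n1 s3 s4 sg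
  refine ⟨_, _, _, .const g1 g2 g3 n3.ne n2.ne n1.ne, by simp, by simp, by simp, ?_, ?_⟩
  · simpa using (s3.trans s4).le
  · refine sg.le.trans (le_of_eq ?_)
    unfold gain
    have i := (hX.const_mul p.2.2.1).neg
    have a1 := integral_sub (i.sub (integrable_const (p.2.1 * (φ₁ (p.2.2.1 / p.2.1)).toReal)))
      (integrable_const (p.1 * (φ₂ (p.2.1 / p.1)).toReal))
    have a2 := integral_sub i (integrable_const (p.2.1 * (φ₁ (p.2.2.1 / p.2.1)).toReal))
    simp only [Pi.sub_apply, Pi.neg_apply, integral_neg, integral_const_mul, integral_const,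
      probReal_univ, one_smul] at a1 a2
    rw [a1, a2]

/-- Finite maxima of Lagrangians at constant densities are attained by bounded densities, pasted
from the constants on the sets where each of them is maximal. -/
theorem exists_isBoundedDensity_eq_partialSups (hX : Measurable X)
    (m₁ : Measurable φ₁) (m₂ : Measurable φ₂) (m₃ : Measurable φ₃) (θ₁ θ₂ θ₃ lam : ℝ)
    {u v w : ℕ → ℝ} (hz : ∀ n, IsBoundedDensity φ₁ φ₂ φ₃ (fun _ : Ω => u n) (fun _ => v n)
      (fun _ => w n)) (n : ℕ) :
    ∃ U V W : Ω → ℝ, IsBoundedDensity φ₁ φ₂ φ₃ U V W ∧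
      partialSups (fun k ω => lagrangian φ₁ φ₂ φ₃ θ₁ θ₂ θ₃ lam (X ω) (u k) (v k) (w k)) n
        = fun ω => lagrangian φ₁ φ₂ φ₃ θ₁ θ₂ θ₃ lam (X ω) (U ω) (V ω) (W ω) := by
  classical
  induction n with
  | zero => exact ⟨_, _, _, hz 0, by rw [partialSups_zero]⟩
  | succ n ih =>
    obtain ⟨U, V, W, h, e⟩ := ih
    have mU := h.measurable_fst
    have mV := h.measurable_snd
    have mW := h.measurable_thd
    set F : Ω → ℝ := fun ω => lagrangian φ₁ φ₂ φ₃ θ₁ θ₂ θ₃ lam (X ω) (U ω) (V ω) (W ω) with hF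
    set F' : Ω → ℝ := fun ω =>
      lagrangian φ₁ φ₂ φ₃ θ₁ θ₂ θ₃ lam (X ω) (u (n + 1)) (v (n + 1)) (w (n + 1)) with hF'
    have mF : Measurable F := by unfold F lagrangian gain; fun_prop
    have mF' : Measurable F' := by unfold F' lagrangian gain; fun_prop
    have hs : MeasurableSet {ω | F' ω ≤ F ω} := measurableSet_le mF' mF
    refine ⟨_, _, _, h.piecewise (hz (n + 1)) hs, ?_⟩
    rw [partialSups_add_one, e]
    ext ω
    rw [Pi.sup_apply]
    by_cases hω : F' ω ≤ F ω
    · simpa only [mem_ofPred_eq, hω, piecewise_eq_of_mem] using sup_eq_left.2 hω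
    · simpa [hω] using sup_eq_right.2 (not_le.1 hω).le

/-- Interchange of supremum and integral: a bound on the integrated Lagrangian at all bounded
densities bounds the expectation of the pointwise supremum `gammaStar`. -/
theorem expectation_gammaStar_le [IsProbabilityMeasure P₀] (hXm : Measurable X)
    (hX : Integrable X P₀) (h₁ : IsDivergenceFunction φ₁) (m₁ : Measurable φ₁)
    (h₂ : IsDivergenceFunction φ₂) (m₂ : Measurable φ₂)
    (h₃ : IsDivergenceFunction φ₃) (m₃ : Measurable φ₃) {θ₁ θ₂ θ₃ K : ℝ} {lam : ℝ≥0}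
    (hlam : lam ≠ 0) (hK : ∀ U V W : Ω → ℝ, IsBoundedDensity φ₁ φ₂ φ₃ U V W →
      ∫ ω, lagrangian φ₁ φ₂ φ₃ θ₁ θ₂ θ₃ lam (X ω) (U ω) (V ω) (W ω) ∂P₀ ≤ K) :
    expectation P₀ (fun ω => gammaStar φ₁ φ₂ φ₃ (X ω) θ₁ θ₂ θ₃ lam) ≤ (K : EReal) := by
  have hne : {z : ℚ × ℚ × ℚ | 0 < z.1 ∧ 0 < z.2.1 ∧ 0 < z.2.2 ∧ φ₃ z.1 ≠ ∞ ∧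
      φ₂ (z.2.1 / z.1) ≠ ∞ ∧ φ₁ (z.2.2 / z.2.1) ≠ ∞}.Nonempty :=
    ⟨(1, 1, 1), by simp [h₁.map_one, h₂.map_one, h₃.map_one]⟩
  obtain ⟨z, hz⟩ := (to_countable _).exists_eq_range hne
  have hzmem : ∀ n, z n ∈ range z := mem_range_self
  rw [← hz] at hzmem
  have hconst : ∀ n, IsBoundedDensity φ₁ φ₂ φ₃ (fun _ : Ω => ((z n).1 : ℝ))
      (fun _ => ((z n).2.1 : ℝ)) (fun _ => ((z n).2.2 : ℝ)) := by
    intro n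
    obtain ⟨a, b, c, d, e, f⟩ := hzmem n
    exact .const (by exact_mod_cast a) (by exact_mod_cast b) (by exact_mod_cast c) d e f
  have hsel := exists_isBoundedDensity_eq_partialSups hXm m₁ m₂ m₃ θ₁ θ₂ θ₃ lam hconst
  set f := partialSups (fun k ω =>
    lagrangian φ₁ φ₂ φ₃ θ₁ θ₂ θ₃ lam (X ω) (z k).1 (z k).2.1 (z k).2.2) with hf
  have hint : ∀ U V W : Ω → ℝ, IsBoundedDensity φ₁ φ₂ φ₃ U V W → Integrable (fun ω =>
      lagrangian φ₁ φ₂ φ₃ θ₁ θ₂ θ₃ lam (X ω) (U ω) (V ω) (W ω)) P₀ := fun U V W h =>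
    ((((h.integrable_gain m₁ m₂ hX).add (h.integrable_fst.const_mul θ₁)).add
      (h.integrable_snd.const_mul θ₂)).add (h.integrable_thd.const_mul θ₃)).sub
      ((h.integrable_div_fst m₃).const_mul (lam : ℝ))
  refine expectation_le_of_monotone (f := f)
    ((measurable_gammaStar h₁ h₂ h₃ θ₁ θ₂ θ₃ lam).comp hXm) ?_ ?_ f.monotone ?_ ?_ ?_
  · intro n
    obtain ⟨U, V, W, h, e⟩ := hsel n
    have mU := h.measurable_fst
    have mV := h.measurable_snd
    have mW := h.measurable_thd
    rw [e]
    unfold lagrangian gain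
    fun_prop
  · intro n
    obtain ⟨U, V, W, h, e⟩ := hsel n
    rw [e]
    exact hint U V W h
  · intro n ω
    obtain ⟨U, V, W, h, e⟩ := hsel n
    rw [e]
    exact lagrangian_le_gammaStar h₁ h₂ h₃ (X ω) θ₁ θ₂ θ₃ lam (h.pos_fst ω) (h.pos_snd ω)
      (h.finite_fst ω) (h.finite_snd ω) (h.finite_thd ω)
  · intro ω c hc
    obtain ⟨u, v, w, a1, a2, a3, a4, a5, a6, hlt⟩ :=
      exists_rat_lt_lagrangian h₁ h₂ h₃ (X ω) θ₁ θ₂ θ₃ hlam hc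
    have hmem : (u, v, w) ∈ range z := by
      rw [← hz]
      exact ⟨a1, a2, a3, a4, a5, a6⟩
    obtain ⟨n, hn⟩ := hmem
    refine ⟨n, hlt.trans_le ?_⟩
    have := le_partialSups (fun k ω =>
      lagrangian φ₁ φ₂ φ₃ θ₁ θ₂ θ₃ lam (X ω) (z k).1 (z k).2.1 (z k).2.2) n ω
    simpa only [hn] using this
  · intro n
    obtain ⟨U, V, W, h, e⟩ := hsel n
    rw [e]
    exact hK U V W h

theorem dual_le_globalizedOCE [IsProbabilityMeasure P₀] (hXm : Measurable X)
    (hX : Integrable X P₀) (h₁ : IsDivergenceFunction φ₁) (m₁ : Measurable φ₁)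
    (h₂ : IsDivergenceFunction φ₂) (m₂ : Measurable φ₂)
    (h₃ : IsDivergenceFunction φ₃) (m₃ : Measurable φ₃) {r : ℝ} (hr : 0 < r) :
    ⨅ (lam : ℝ≥0) (θ₁ : ℝ) (θ₂ : ℝ) (θ₃ : ℝ),
        (((-θ₁ - θ₂ - θ₃ + (lam : ℝ) * r : ℝ) : EReal)
          + expectation P₀ (fun ω => gammaStar φ₁ φ₂ φ₃ (X ω) θ₁ θ₂ θ₃ lam))
      ≤ globalizedOCE φ₁ φ₂ φ₃ r P₀ X := by
  by_cases htop : globalizedOCE φ₁ φ₂ φ₃ r P₀ X = ⊤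
  · rw [htop]; exact le_top
  have hfeas := fun U V W (h : IsBoundedDensity φ₁ φ₂ φ₃ U V W) =>
    h.integral_gain_le_globalizedOCE (P₀ := P₀) (r := r) m₁ m₂ m₃ hXm hX
  have hslater := eventually_mem_valueHypograph hX h₁ h₂ h₃ hr
  have hbot : globalizedOCE φ₁ φ₂ φ₃ r P₀ X ≠ ⊥ := by
    obtain ⟨U, V, W, h, hU, hV, hW, hρ, -⟩ := hslater.self_of_nhds
    exact ((EReal.bot_lt_coe _).trans_le (hfeas U V W h hU hV hW hρ)).ne'
  obtain ⟨L, hL⟩ : ∃ L : ℝ, globalizedOCE φ₁ φ₂ φ₃ r P₀ X = L :=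
    ⟨_, (EReal.coe_toReal htop hbot).symm⟩
  rw [hL] at hfeas ⊢
  obtain ⟨l, hl⟩ := exists_supergradient (convex_valueHypograph hX h₁ m₁ h₂ m₂ h₃ m₃)
    (fun x y y' ⟨U, V, W, h, hU, hV, hW, hρ, hy⟩ hle =>
      ⟨U, V, W, h, hU, hV, hW, hρ, hle.trans hy⟩) hslater
    (fun y ⟨U, V, W, h, hU, hV, hW, hρ, hy⟩ =>
      hy.trans (EReal.coe_le_coe_iff.1 (hfeas U V W h hU hV hW hρ)))
  have hdec : ∀ a b c ρ : ℝ, l (a, b, c, ρ) = a * l (1, 0, 0, 0) + b * l (0, 1, 0, 0)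
      + c * l (0, 0, 1, 0) + ρ * l (0, 0, 0, 1) := by
    intro a b c ρ
    have e : (a, b, c, ρ) = a • ((1, 0, 0, 0) : ℝ × ℝ × ℝ × ℝ) + b • (0, 1, 0, 0)
        + c • (0, 0, 1, 0) + ρ • (0, 0, 0, 1) := by simp
    rw [e]
    rw [map_add, map_add, map_add, map_smul, map_smul, map_smul, map_smul]
    rfl
  set θ₁ := -l (1, 0, 0, 0) with hθ₁
  set θ₂ := -l (0, 1, 0, 0) with hθ₂
  set θ₃ := -l (0, 0, 1, 0) with hθ₃
  set lam := l (0, 0, 0, 1) with hlam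
  have hl' : ∀ a b c ρ y : ℝ, ((a, b, c, ρ), y) ∈ valueHypograph φ₁ φ₂ φ₃ P₀ X →
      y + θ₁ * a + θ₂ * b + θ₃ * c - lam * ρ ≤ L + θ₁ + θ₂ + θ₃ - lam * r := by
    intro a b c ρ y hp
    have := hl _ hp
    rw [Prod.mk_sub_mk, Prod.mk_sub_mk, Prod.mk_sub_mk, hdec] at this
    dsimp only at this
    linarith
  -- the constraint on the divergence may be relaxed arbitrarily, so its multiplier is nonnegative
  have hlam0 : 0 ≤ lam := by
    by_contra! hneg
    obtain ⟨U, V, W, h, hU, hV, hW, hρ, hy⟩ := hslater.self_of_nhds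
    set m := -∫ ω, X ω ∂P₀ - 1
    have hmL : m ≤ L := hy.trans (EReal.coe_le_coe_iff.1 (hfeas U V W h hU hV hW hρ))
    have hs : 0 ≤ (L - m + 1) / -lam := div_nonneg (by linarith) (by linarith)
    have := hl' 1 1 1 (r + (L - m + 1) / -lam) m
      ⟨U, V, W, h, hU, hV, hW, hρ.trans (by simpa using hs), hy⟩
    have e : lam * ((L - m + 1) / -lam) = -(L - m + 1) := by
      field_simp [hneg.ne]
    rw [mul_add, e] at this
    linarith
  refine le_of_forall_gt fun q hq => ?_
  obtain ⟨q', hLq, hq'⟩ := EReal.lt_iff_exists_real_btwn.1 hq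
  rw [EReal.coe_lt_coe_iff] at hLq
  refine lt_of_le_of_lt ?_ hq'
  -- a slightly larger, hence positive, multiplier costs at most `q' - L`
  set ε := (q' - L) / r with hε
  have hε0 : 0 < ε := div_pos (by linarith) hr
  have hεr : ε * r = q' - L := by rw [hε]; field_simp
  set lam' : ℝ≥0 := ⟨lam + ε, by linarith⟩ with hlam'
  have hlam'0 : lam' ≠ 0 := by
    rw [Ne, ← NNReal.coe_eq_zero]
    exact (by linarith : (0 : ℝ) < lam + ε).ne'
  have hval := expectation_gammaStar_le (P₀ := P₀) (X := X) (θ₁ := θ₁) (θ₂ := θ₂) (θ₃ := θ₃)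
    (K := L + θ₁ + θ₂ + θ₃ - lam * r) hXm hX h₁ m₁ h₂ m₂ h₃ m₃ hlam'0 (by
      intro U V W h
      have hmem := hl' _ _ _ _ _ ⟨U, V, W, h, rfl, rfl, rfl, le_rfl, le_rfl⟩
      have i1 := (h.integrable_gain m₁ m₂ hX).add (h.integrable_fst.const_mul θ₁)
      have i2 := i1.add (h.integrable_snd.const_mul θ₂)
      have i3 := i2.add (h.integrable_thd.const_mul θ₃)
      have a1 := integral_sub i3 ((h.integrable_div_fst m₃).const_mul (lam' : ℝ))
      have a2 := integral_add i2 (h.integrable_thd.const_mul θ₃)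
      have a3 := integral_add i1 (h.integrable_snd.const_mul θ₂)
      have a4 := integral_add (h.integrable_gain m₁ m₂ hX) (h.integrable_fst.const_mul θ₁)
      simp only [Pi.add_apply, integral_const_mul] at a1 a2 a3 a4
      unfold lagrangian
      rw [a1, a2, a3, a4]
      have hnn : 0 ≤ ∫ ω, (φ₃ (U ω)).toReal ∂P₀ := integral_nonneg fun _ => ENNReal.toReal_nonneg
      have e : (lam' : ℝ) = lam + ε := rfl
      rw [e]
      nlinarith)
  refine (iInf_le_of_le lam' <| iInf_le_of_le θ₁ <| iInf_le_of_le θ₂ <| iInf_le_of_le θ₃ <|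
    add_le_add_right hval _).trans ?_
  rw [← EReal.coe_add, EReal.coe_le_coe_iff]
  have e : (lam' : ℝ) = lam + ε := rfl
  rw [e]
  linarith

end StrongDuality

/-- All measures in the primal problem are absolutely continuous with respect to `P₀`. -/
theorem globalizedOCE_congr (φ₁ φ₂ φ₃ : ℝ → ℝ≥0∞) (r : ℝ) {P₀ : Measure Ω} {X Y : Ω → ℝ}
    (h : X =ᵐ[P₀] Y) : globalizedOCE φ₁ φ₂ φ₃ r P₀ X = globalizedOCE φ₁ φ₂ φ₃ r P₀ Y := by
  unfold globalizedOCE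
  refine iSup_congr fun P => iSup_congr fun _ => iSup_congr fun hP => iSup_congr fun Q =>
    iSup_congr fun _ => iSup_congr fun hQ => iSup_congr fun Q' => iSup_congr fun _ =>
    iSup_congr fun hQ' => ?_
  have hPP : P ≪ P₀ := by
    by_contra hn
    rw [divergence, if_neg hn] at hP
    exact absurd hP (by simp)
  have := ((hQ'.trans hQ).trans hPP).ae_le h
  rw [expectation_congr (Y := fun ω => ((-X ω : ℝ) : EReal)) (Z := fun ω => ((-Y ω : ℝ) : EReal))]
  filter_upwards [this] with ω hω
  rw [hω]

end GlobalizedOCE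

theorem theorem3 {Ω : Type*} [MeasurableSpace Ω]
    (P₀ : MeasureTheory.Measure Ω) [MeasureTheory.IsProbabilityMeasure P₀]
    (X : Ω → ℝ) (hX : MeasureTheory.Integrable X P₀)
    (φ₁ φ₂ φ₃ : ℝ → ℝ≥0∞)
    (hφ₁ : GlobalizedOCE.IsDivergenceFunction φ₁) (hφ₁_lsc : LowerSemicontinuous φ₁)
    (hφ₂ : GlobalizedOCE.IsDivergenceFunction φ₂) (hφ₂_lsc : LowerSemicontinuous φ₂)
    (hφ₃ : GlobalizedOCE.IsDivergenceFunction φ₃) (hφ₃_lsc : LowerSemicontinuous φ₃)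
    (r : ℝ) (hr : 0 < r) :
    GlobalizedOCE.globalizedOCE φ₁ φ₂ φ₃ r P₀ X =
      ⨅ (lam : ℝ≥0) (θ₁ : ℝ) (θ₂ : ℝ) (θ₃ : ℝ),
        (((-θ₁ - θ₂ - θ₃ + (lam : ℝ) * r : ℝ) : EReal)
          + GlobalizedOCE.expectation P₀
              (fun ω => GlobalizedOCE.gammaStar φ₁ φ₂ φ₃ (X ω) θ₁ θ₂ θ₃ lam)) := by
  obtain ⟨Y, hYm, hXY⟩ := hX.aemeasurable
  have hY : Integrable Y P₀ := hX.congr hXY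
  rw [GlobalizedOCE.globalizedOCE_congr φ₁ φ₂ φ₃ r hXY]
  have hE : ∀ (lam : ℝ≥0) (θ₁ θ₂ θ₃ : ℝ),
      GlobalizedOCE.expectation P₀
        (fun ω => GlobalizedOCE.gammaStar φ₁ φ₂ φ₃ (X ω) θ₁ θ₂ θ₃ lam) =
      GlobalizedOCE.expectation P₀
        (fun ω => GlobalizedOCE.gammaStar φ₁ φ₂ φ₃ (Y ω) θ₁ θ₂ θ₃ lam) := fun lam θ₁ θ₂ θ₃ =>
    GlobalizedOCE.expectation_congr
      (hXY.fun_comp fun x => GlobalizedOCE.gammaStar φ₁ φ₂ φ₃ x θ₁ θ₂ θ₃ lam)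
  simp only [hE]
  refine le_antisymm ?_ (GlobalizedOCE.dual_le_globalizedOCE hYm hY hφ₁ hφ₁_lsc.measurable
    hφ₂ hφ₂_lsc.measurable hφ₃ hφ₃_lsc.measurable hr)
  refine le_iInf fun lam => le_iInf fun θ₁ => le_iInf fun θ₂ => le_iInf fun θ₃ => ?_
  refine iSup_le fun P => iSup_le fun _ => iSup_le fun hP => iSup_le fun Q => iSup_le fun _ =>
    iSup_le fun hQ => iSup_le fun Q' => iSup_le fun _ => iSup_le fun hQ' => ?_
  exact GlobalizedOCE.objective_le_dual hYm hY hφ₁ hφ₁_lsc.measurable hφ₂ hφ₂_lsc.measurable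
    hφ₃ hφ₃_lsc.measurable hr.le θ₁ θ₂ θ₃ lam hP hQ hQ'
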